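/- Let $\mathcal D\subset\mathbb R^d$ be a bounded open set (for instance a bounded Lipschitz domain), let $H=L^2(\mathcal D)$ with norm $\|\cdot\|$, and let $A$ be the Laplacian on $\mathcal D$ with homogeneous Neumann boundary condition, or, if $\mathcal D$ is an open box, with periodic boundary condition; that is, $A$ is the operator associated with the form $\int_{\mathcal D}\nabla u\cdot\nabla v\,dx$ on $H^1(\mathcal D)$, respectively on the periodic space $H^1_{\rm per}(\mathcal D)$. Assume that $H$ has an orthonormal basis $(e_k)_{k\ge 0}$ with $-Ae_k=\lambda_ke_k$, where $0=\lambda_0<\lambda_1\le\lambda_2\le\cdots$ and $\lambda_k\to\infty$. For $\gamma\ge 0$ let $H^\gamma$ be the space of $v\in H$ with $$\|v\|_{H^\gamma}^2:=|\langle e_0,v\rangle|^2+\sum_{k\ge 1}\lambda_k^\gamma|\langle e_k,v\rangle|^2<\infty ,$$ and let $P^N$ be the orthogonal projection of $H$ onto $V_N:=\mathrm{span}\{e_0,\dots,e_N\}$. Fix $\mathbf s\ge 0$, $T>0$, $c\ge 0$, $\alpha\ge 0$, $\bar\epsilon\in\mathbb R$, and a deterministic initial value $u(0)\in H^{\mathbf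 s}$ that has a continuous representative on $\mathcal D$ with $\sup_{\mathcal D}|u(0)|<1$. Let $B$ map $H$ to the bounded linear operators on $H$ and satisfy one of the following. - Case 1: there is a constant $C_{\mathbf s}\ge 0$ such that for all $0\le\gamma\le\mathbf s$ and $u,v\in H^\gamma$, $$\|B(u)-B(v)\|_{\mathcal L_2(H,H^\gamma)}\le C_{\mathbf s}\|u-v\|_{H^\gamma},\qquad \|B(u)\|_{\mathcal L_2(H,H^\gamma)}\le C_{\mathbf s}(1+\|u\|_{H^\gamma}),$$ where $\mathcal L_2$ denotes Hilbert--Schmidt operators. - Case 2: $B(v)e_i=h_i(v)$ for all $v\in H$ and $i\ge 0$, with $h_i\in W^{\mathbf s+1,\infty}_0[-1,1]$ and $\sum_i\|h_i\|^2_{W^{\mathbf s+1,\infty}}<\infty$; here $W^{\mathbf s+1,\infty}_0[-1,1]$ consists of the functions whose extension by zero to $\mathbb R$ lies in $W^{\mathbf s+1,\infty}(\mathbb R)$, and $h_i$ is so extended. For $\delta>0$ put $$\begin{aligned}F^\delta_{\log,1}(\xi)={}&\tfrac12(\xi+1)\ln((\xi+1)^2+\delta)+\sqrt\delta\arctan\tfrac{\xi+1}{\sqrt\delta}-\xi\\&-\Big(\tfrac12(\xi-1)\ln((\xi-1)^2+\delta)+\sqrt\delta\arctan\tfrac{\xi-1}{\sqrt\delta}-\xi\Big).\end{aligned}$$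 Let $W(t)=\sum_i\beta_i(t)e_i$ be a cylindrical Wiener process on $H$, with respect to a filtration $(\mathcal F_t)$, on some probability space $(\Omega,\mathcal F,\mathbb P)$. For $N,J\in\mathbb N^+$, $\tau=T/J$ and $t_j=j\tau$, let $u_0^N,\dots,u_J^N$ be a $V_N$-valued solution, $u_j^N$ being $\mathcal F_{t_j}$-measurable, of the stabilized semi-implicit spectral Galerkin scheme: $u_0^N=P^Nu(0)$ and, for $0\le j<J$, $$u_{j+1}^N=u_j^N+(A+2c)\tau u_{j+1}^N-P^N(F^\delta_{\log,1})'(u_j^N)\,\tau-\alpha(u_{j+1}^N-u_j^N)\tau+\epsilon P^NB(u_j^N)\big(W(t_{j+1})-W(t_j)\big)$$ almost surely. Only those $N,J$ are considered for which this linear implicit equation for $u_{j+1}^N$ is uniquely solvable in $V_N$, that is, $1+(\alpha-2c+\lambda_k)\tau\neq 0$ for all $0\le k\le N$ (which holds for instance whenever $(2c-\alpha)\tau<1$). Then for every real $p\ge 1$ there is a constant $C$, depending only on $p$, $T$, $u(0)$ and the fixed data $\mathcal D$, $A$, $(e_k)$, $B$, $c$, $\alpha$, $\bar\epsilon$, $\mathbf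 s$, and not on $\delta$, $\epsilon$, $N$, $J$, $j$, the probability space or the Wiener process, such that for all $\delta>0$, all $0\le\epsilon\le\bar\epsilon$, all such $N$ and $J$, and all $0\le j\le J$, $$\|u_j^N\|_{L^{2p}(\Omega;H)}\le C\big(1+|\ln\delta|\,\tau^{1/2}\big).$$ -/

import Mathlib

open MeasureTheory ProbabilityTheory Filter Topology
open scoped NNReal ENNReal

noncomputable section

namespace LogSAC

/-- The real Hilbert space `L²(D)`. -/
abbrev L2 {d : ℕ} (D : Set (EuclideanSpace ℝ (Fin d))) : Type :=
  Lp ℝ 2 (volume.restrict D)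

section Laplacian

variable {d : ℕ}

/-- Homogeneous Neumann condition, or periodic condition on the box with corner `a` and
side lengths `L`. -/
inductive BoundaryCondition (d : ℕ) : Type
  | neumann : BoundaryCondition d
  | periodic (a L : Fin d → ℝ) : BoundaryCondition d

/-- Neumann: `D` is a bounded open set.  Periodic: `D` is the open box `∏ (aᵢ, aᵢ + Lᵢ)`. -/
def BoundaryCondition.Admissible (bc : BoundaryCondition d)
    (D : Set (EuclideanSpace ℝ (Fin d))) : Prop :=
  match bc with
  | .neumann => IsOpen D ∧ Bornology.IsBounded D
  | .periodic a L => (∀ i, 0 < L i) ∧ D = {x | ∀ i, a i < x i ∧ x i < a i + L i}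

/-- Test functions defining the weak gradient: `C_c^∞(D)` in the Neumann case, smooth
`L`-periodic functions on `ℝ^d` in the periodic case (so that the resulting first order
Sobolev spaces are `H¹(D)` and `H¹_per(D)` respectively). -/
def IsTestFunction (bc : BoundaryCondition d) (D : Set (EuclideanSpace ℝ (Fin d)))
    (φ : EuclideanSpace ℝ (Fin d) → ℝ) : Prop :=
  ContDiff ℝ (⊤ : ℕ∞) φ ∧
    match bc with
    | .neumann => HasCompactSupport φ ∧ tsupport φ ⊆ D
    | .periodic _ L => ∀ i x, φ (x + EuclideanSpace.single i (L i)) = φ x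

/-- `u` belongs to the first order Sobolev space of the boundary condition, with weak
gradient `g`. -/
def HasWeakGradient (bc : BoundaryCondition d) {D : Set (EuclideanSpace ℝ (Fin d))}
    (u : L2 D) (g : Fin d → L2 D) : Prop :=
  ∀ φ, IsTestFunction bc D φ → ∀ i,
    ∫ x in D, u x * fderiv ℝ φ x (EuclideanSpace.single i 1) = - ∫ x in D, g i x * φ x

/-- `u` lies in the domain of the Laplacian `A` with the given boundary condition, and
`A u = w`: this is the operator associated with the form `∫ ∇u · ∇v` on `H¹(D)`
(respectively `H¹_per(D)`). -/
def IsLaplacian (bc : BoundaryCondition d) {D : Set (EuclideanSpace ℝ (Fin d))}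
    (u w : L2 D) : Prop :=
  ∃ g, HasWeakGradient bc u g ∧
    ∀ v h, HasWeakGradient bc v h → ∑ i, inner ℝ (g i) (h i) = - inner ℝ w v

/-- `e` is an orthonormal basis of `L²(D)` with `-A eₖ = lam k • eₖ`, where
`0 = lam 0 < lam 1 ≤ lam 2 ≤ … → ∞`. -/
structure IsEigenbasis (bc : BoundaryCondition d) {D : Set (EuclideanSpace ℝ (Fin d))}
    (e : HilbertBasis ℕ ℝ (L2 D)) (lam : ℕ → ℝ) : Prop where
  eigen : ∀ k, IsLaplacian bc (e k) (-(lam k • e k))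
  zero : lam 0 = 0
  pos : 0 < lam 1
  mono : Monotone lam
  tendsto : Tendsto lam atTop atTop

end Laplacian

section Spaces

variable {d : ℕ} {D : Set (EuclideanSpace ℝ (Fin d))}

/-- The norm of `H^γ`, in terms of the eigenbasis:
`‖v‖² = |⟨e₀, v⟩|² + ∑_{k ≥ 1} lam k ^ γ |⟨eₖ, v⟩|²`; it is `∞` if `v ∉ H^γ`. -/
def sobolevNorm (e : HilbertBasis ℕ ℝ (L2 D)) (lam : ℕ → ℝ) (γ : ℝ) (v : L2 D) : ℝ≥0∞ :=
  (‖inner ℝ (e 0) v‖ₑ ^ 2 +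
    ∑' k, ENNReal.ofReal (lam (k + 1) ^ γ) * ‖inner ℝ (e (k + 1)) v‖ₑ ^ 2) ^ (1 / 2 : ℝ)

/-- The norm of `𝓛₂(H, H^γ)`; it is `∞` if `S` is not a Hilbert-Schmidt operator
into `H^γ`. -/
def hsNorm (e : HilbertBasis ℕ ℝ (L2 D)) (lam : ℕ → ℝ) (γ : ℝ) (S : L2 D →L[ℝ] L2 D) :
    ℝ≥0∞ :=
  (∑' i, sobolevNorm e lam γ (S (e i)) ^ 2) ^ (1 / 2 : ℝ)

/-- Superposition operator `v ↦ g ∘ v` on `L²(D)` (with value `0` if `g ∘ v ∉ L²(D)`, which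
does not happen for bounded continuous `g` and bounded `D`, see `memLp_comp`). -/
def superpose (g : ℝ → ℝ) (v : L2 D) : L2 D :=
  open Classical in
  if hg : MemLp (fun x => g (v x)) 2 (volume.restrict D) then hg.toLp else 0

theorem memLp_comp (hD : Bornology.IsBounded D) {g : ℝ → ℝ} (hg : Continuous g) {M : ℝ}
    (hM : ∀ x, |g x| ≤ M) (v : L2 D) : MemLp (fun x => g (v x)) 2 (volume.restrict D) := by
  have : IsFiniteMeasure (volume.restrict D) :=
    ⟨by simpa using hD.measure_lt_top⟩
  exact MemLp.of_bound (hg.comp_aestronglyMeasurable (Lp.aestronglyMeasurable v)) M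
    (Eventually.of_forall fun x => by simpa using hM (v x))

/-- The initial value belongs to `H^s` and has a representative in `C(D)` of supremum norm
smaller than one. -/
def IsInitialValue (e : HilbertBasis ℕ ℝ (L2 D)) (lam : ℕ → ℝ) (s : ℝ) (u₀ : L2 D) : Prop :=
  sobolevNorm e lam s u₀ < ∞ ∧
    ∃ w : EuclideanSpace ℝ (Fin d) → ℝ, ContinuousOn w D ∧ (∃ r < 1, ∀ x ∈ D, |w x| ≤ r) ∧
      u₀ =ᵐ[volume.restrict D] w

/-- Orthogonal projection `P^N` of `L²(D)` onto the span of `e₀, …, e_N`. -/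
def galerkinProj (e : HilbertBasis ℕ ℝ (L2 D)) (N : ℕ) (v : L2 D) : L2 D :=
  ∑ k ∈ Finset.range (N + 1), inner ℝ (e k) v • e k

end Spaces

section Potential

/-- The regularized logarithmic potential without its quadratic part, `F_{log,1}^δ`, so that
`F_log^δ (ξ) = F_{log,1}^δ (ξ) - c ξ²`. -/
def Flog1 (δ ξ : ℝ) : ℝ :=
  (1 / 2 * (ξ + 1) * Real.log ((ξ + 1) ^ 2 + δ) + √δ * Real.arctan ((ξ + 1) / √δ) - ξ)
    - (1 / 2 * (ξ - 1) * Real.log ((ξ - 1) ^ 2 + δ) + √δ * Real.arctan ((ξ - 1) / √δ) - ξ)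

theorem hasDerivAt_Flog1 {δ : ℝ} (hδ : 0 < δ) (ξ : ℝ) :
    HasDerivAt (Flog1 δ)
      (1 / 2 * Real.log ((ξ + 1) ^ 2 + δ) - 1 / 2 * Real.log ((ξ - 1) ^ 2 + δ)) ξ := by
  have hs : 0 < √δ := Real.sqrt_pos.2 hδ
  have key : ∀ a : ℝ, HasDerivAt (fun ξ : ℝ => 1 / 2 * (ξ + a) * Real.log ((ξ + a) ^ 2 + δ) +
      √δ * Real.arctan ((ξ + a) / √δ) - ξ) (1 / 2 * Real.log ((ξ + a) ^ 2 + δ)) ξ := by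
    intro a
    have hne : (ξ + a) ^ 2 + δ ≠ 0 := by positivity
    have h0 : HasDerivAt (fun ξ : ℝ => ξ + a) 1 ξ := (hasDerivAt_id ξ).add_const a
    have h1 := (((h0.const_mul (1 / 2)).mul (((h0.pow 2).add_const δ).log hne)).add
      (((h0.div_const (√δ)).arctan).const_mul (√δ))).sub (hasDerivAt_id ξ)
    refine h1.congr_deriv ?_
    have h2 : (1 : ℝ) + ((ξ + a) / √δ) ^ 2 = ((ξ + a) ^ 2 + δ) / δ := by
      rw [div_pow, Real.sq_sqrt hδ.le]; field_simp; ring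
    rw [h2]
    simp only [Pi.pow_apply]
    field_simp
    ring
  have h := (key 1).sub (key (-1))
  refine (h.congr_deriv (by simp only [sub_eq_add_neg])).congr_of_eventuallyEq
    (Eventually.of_forall fun x => ?_)
  simp [Flog1, sub_eq_add_neg]

end Potential

section Noise

/-- The norm of `W^{s+1,∞}` (for fractional `s` with a Hölder seminorm of order `s - ⌊s⌋` of
the highest derivative).  The supremum of the derivative of order `⌊s⌋ + 1` is the Lipschitz
constant of the derivative of order `⌊s⌋`. -/
def wNorm (s : ℝ) (h : ℝ → ℝ) : ℝ≥0∞ :=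
  (∑ k ∈ Finset.range (⌊s⌋₊ + 1), ⨆ x, ‖iteratedDeriv k h x‖ₑ)
    + eHolderNorm 1 (iteratedDeriv ⌊s⌋₊ h)
    + (open Classical in if s = ⌊s⌋₊ then 0 else
        eHolderNorm (s - ⌊s⌋₊).toNNReal (iteratedDeriv (⌊s⌋₊ + 1) h))

/-- `h ∈ W_0^{s+1,∞}[-1,1]`, where functions are extended by zero to the real line: the
extension belongs to `W^{s+1,∞}`. -/
structure MemW0 (s : ℝ) (h : ℝ → ℝ) : Prop where
  support : ∀ x, 1 ≤ |x| → h x = 0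
  contDiff : ContDiff ℝ ⌊s⌋₊ h
  contDiff_succ : s ≠ ⌊s⌋₊ → ContDiff ℝ (⌊s⌋₊ + 1 : ℕ) h
  finite : wNorm s h < ∞

variable {d : ℕ} {D : Set (EuclideanSpace ℝ (Fin d))}

/-- Case 1: Lipschitz continuity and linear growth of `B : H^γ → 𝓛₂(H, H^γ)`,
`0 ≤ γ ≤ s`. -/
def NoiseCase1 (e : HilbertBasis ℕ ℝ (L2 D)) (lam : ℕ → ℝ) (s : ℝ)
    (B : L2 D → L2 D →L[ℝ] L2 D) : Prop :=
  ∃ K : ℝ≥0, ∀ γ : ℝ, 0 ≤ γ → γ ≤ s → ∀ u v : L2 D,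
    sobolevNorm e lam γ u < ∞ → sobolevNorm e lam γ v < ∞ →
      hsNorm e lam γ (B u - B v) ≤ K * sobolevNorm e lam γ (u - v) ∧
      hsNorm e lam γ (B u) ≤ K * (1 + sobolevNorm e lam γ u)

/-- Case 2: `B(v) eᵢ = hᵢ(v)` with `hᵢ ∈ W_0^{s+1,∞}[-1,1]` and
`∑ᵢ ‖hᵢ‖² < ∞`. -/
def NoiseCase2 (e : HilbertBasis ℕ ℝ (L2 D)) (s : ℝ) (B : L2 D → L2 D →L[ℝ] L2 D) : Prop :=
  ∃ h : ℕ → ℝ → ℝ, (∀ i, MemW0 s (h i)) ∧ ∑' i, wNorm s (h i) ^ 2 < ∞ ∧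
    ∀ v i, B v (e i) = superpose (h i) v

/-- `W(t) = ∑ᵢ βᵢ(t) eᵢ` is a cylindrical Wiener process with respect to the filtration `ℱ`:
the `βᵢ` are independent standard real Brownian motions, adapted to `ℱ`, and the increments
of all of them together after time `s` are independent of `ℱ s`. -/
structure IsCylindricalWiener {Ω : Type*} {mΩ : MeasurableSpace Ω} (P : Measure Ω)
    (ℱ : Filtration ℝ≥0 mΩ) (β : ℕ → ℝ≥0 → Ω → ℝ) : Prop where
  adapted : ∀ i t, Measurable[ℱ t] (β i t)
  brownian : ∀ i, IsBrownianReal (β i) P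
  indep : iIndepFun (fun i ω t => β i t ω) P
  indep_past : ∀ s t, s ≤ t →
    Indep (⨆ i, MeasurableSpace.comap (fun ω => β i t ω - β i s ω) inferInstance) (ℱ s) P

/-- `X = S (W(t) - W(s))` for the random Hilbert-Schmidt operator `S`: the series
`∑ᵢ (βᵢ(t) - βᵢ(s)) S eᵢ` converges to `X` in probability. -/
def IsNoiseIncrement {Ω : Type*} {mΩ : MeasurableSpace Ω} (P : Measure Ω)
    (e : HilbertBasis ℕ ℝ (L2 D)) (β : ℕ → ℝ≥0 → Ω → ℝ) (s t : ℝ≥0)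
    (S : Ω → L2 D →L[ℝ] L2 D) (X : Ω → L2 D) : Prop :=
  TendstoInMeasure P
    (fun n ω => ∑ i ∈ Finset.range n, (β i t ω - β i s ω) • S ω (e i)) atTop X

end Noise

/-- `u 0, …, u J` is the solution of the stabilized semi-implicit spectral Galerkin scheme
with time step `τ` and Galerkin parameter `N`:
`u_{j+1} = u_j + τ (A + 2c) u_{j+1} - τ P^N (F_{log,1}^δ)'(u_j) - α τ (u_{j+1} - u_j)
  + ε P^N B(u_j) (W(t_{j+1}) - W(t_j))`, `u_0 = P^N u(0)`, `t_j = j τ`. -/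
structure IsScheme {d : ℕ} (bc : BoundaryCondition d) {D : Set (EuclideanSpace ℝ (Fin d))}
    (e : HilbertBasis ℕ ℝ (L2 D)) (B : L2 D → L2 D →L[ℝ] L2 D) (u₀ : L2 D) (c α ε δ : ℝ)
    {Ω : Type*} {mΩ : MeasurableSpace Ω} (P : Measure Ω) (ℱ : Filtration ℝ≥0 mΩ)
    (β : ℕ → ℝ≥0 → Ω → ℝ) (N J : ℕ) (τ : ℝ≥0) (u : ℕ → Ω → L2 D) : Prop where
  adapted : ∀ j ≤ J, StronglyMeasurable[ℱ (j * τ)] (u j)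
  mem_span : ∀ j ≤ J, ∀ᵐ ω ∂P, u j ω ∈ Submodule.span ℝ (e '' Set.Iic N)
  init : ∀ᵐ ω ∂P, u 0 ω = galerkinProj e N u₀
  step : ∀ j < J, ∃ X : Ω → L2 D,
    IsNoiseIncrement P e β (j * τ) ((j + 1 : ℕ) * τ) (fun ω => B (u j ω)) X ∧
    ∀ᵐ ω ∂P, ∃ Au : L2 D, IsLaplacian bc (u (j + 1) ω) Au ∧
      u (j + 1) ω = u j ω + (τ : ℝ) • (Au + (2 * c) • u (j + 1) ω)
        - (τ : ℝ) • galerkinProj e N (superpose (deriv (Flog1 δ)) (u j ω))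
        - (α * τ) • (u (j + 1) ω - u j ω)
        + ε • galerkinProj e N (X ω)

end LogSAC

end

/-! The proof is an energy estimate raised to a high even power. Test one step with `u (j+1) = u j +
w`. The term `⟨F'(u j), u j⟩` is nonnegative because `F'(ξ) ξ ≥ 0`, so the explicit nonlinearity
costs only `τ ⟨F'(u j), w⟩`. Absorbing this into `‖w‖²` leaves `τ² ‖F'(u j)‖²`, and `|F'| ≤ 5 (1 +
|ln δ|)`. The noise splits likewise into `⟨X, u j⟩`, which is kept, and `⟨X, w⟩`, which is absorbed.
With `L = 1 + τ (const · (1 + |ln δ|))²` the result is `L + ‖u (j+1)‖² ≤ (1 + Kτ)(L + ‖u j‖²) + K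
‖P^N X‖² + θ ⟨P^N X, u j⟩`, where `K` and `θ` are deterministic and `K` is independent of `δ`, `ε`,
`N`, `J`.

Given the past, the truncated noise is Gaussian of size `√τ`. In the `m`-th power of the right side
its linear part has mean zero, and everything else is `O(τ)` relative to `(L + ‖u j‖²)^m`. Hence
these moments grow by a factor `1 + Gτ` per step (`lintegral_step_pow_le`), and by at most `exp (G
T)` altogether. Finally `√L` is of order `1 + |ln δ| √τ`.

The energy inequality needs `1 + ατ - 4cτ` bounded away from zero, which can fail only for finitely
many `J`. For those, each coordinate equation is solved directly; the symbols are bounded below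
uniformly in `N` because `lam k → ∞`. `exists_step_bound` joins the two regimes. -/

namespace LogSAC

/-! ### Moments of Gaussian sums with vector coefficients. -/

section GaussianMoments

variable {Ω : Type*} {mΩ : MeasurableSpace Ω} {P : Measure Ω}

/-- A linear combination of independent centred Gaussian variables is Gaussian. -/
theorem map_sum_mul_gaussianReal [IsProbabilityMeasure P] {g : ℕ → Ω → ℝ}
    (hg : ∀ i, Measurable (g i))
    (hind : iIndepFun g P) {v : ℝ≥0} (hlaw : ∀ i, P.map (g i) = gaussianReal 0 v)
    (a : ℕ → ℝ) (n : ℕ) :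
    P.map (fun ω => ∑ i ∈ Finset.range n, a i * g i ω)
      = gaussianReal 0 (v * ∑ i ∈ Finset.range n, ‖a i‖₊ ^ 2) := by
  induction n with
  | zero => simp [gaussianReal_zero_var]
  | succ n ih =>
    have hind' : iIndepFun (fun i ω => a i * g i ω) P :=
      hind.comp (fun i x => a i * x) (fun i => by fun_prop)
    have h1 := hind'.indepFun_finsetSum_of_notMem (fun i => (hg i).const_mul (a i))
      (s := Finset.range n) (i := n) (by simp)
    have h2 : P.map (fun ω => a n * g n ω) = gaussianReal 0 (v * ‖a n‖₊ ^ 2) := by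
      have : (fun ω => a n * g n ω) = (fun x => a n * x) ∘ g n := rfl
      rw [this, ← Measure.map_map (by fun_prop) (hg n), hlaw, gaussianReal_map_const_mul]
      simp only [mul_zero]
      congr 1
      ext
      simp [mul_comm]
    have hs : (∑ j ∈ Finset.range n, fun ω => a j * g j ω)
        = fun ω => ∑ i ∈ Finset.range n, a i * g i ω := by
      ext ω; simp
    rw [hs] at h1
    have h3 := gaussianReal_add_gaussianReal_of_indepFun h1 ih h2
    rw [Finset.sum_range_succ, mul_add, ← add_zero (0 : ℝ), ← h3]
    congr 1
    ext ω
    simp [Finset.sum_range_succ]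

/-- The `L^q` norm of the square of a standard Gaussian variable. -/
noncomputable def gaussianSqNorm (q : ℝ≥0∞) : ℝ≥0∞ :=
  eLpNorm (fun x : ℝ => x ^ 2) q (gaussianReal 0 1)

theorem gaussianSqNorm_lt_top (q : ℝ≥0∞) (hq : q ≠ ∞) : gaussianSqNorm q < ∞ := by
  have h : MemLp (id : ℝ → ℝ) (q * 2) (gaussianReal 0 1) :=
    memLp_id_gaussianReal' _ (ENNReal.mul_ne_top hq (by simp))
  have h2 : MemLp (fun x : ℝ => ‖x‖ ^ (2 : ℝ)) q (gaussianReal 0 1) := by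
    have := h.norm_rpow_div (2 : ℝ≥0∞)
    rw [ENNReal.mul_div_cancel_right (by simp) (by simp)] at this
    simpa using this
  refine lt_of_eq_of_lt ?_ h2.2
  unfold gaussianSqNorm
  congr 1
  ext x
  simp

/-- Scaling: a centred Gaussian of variance `w` has the law of `√w` times a standard one. -/
theorem eLpNorm_sq_of_map_eq_gaussianReal {Y : Ω → ℝ} (hY : Measurable Y) {w : ℝ≥0}
    (hlaw : P.map Y = gaussianReal 0 w) (q : ℝ≥0∞) :
    eLpNorm (fun ω => Y ω ^ 2) q P = w * gaussianSqNorm q := by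
  have h1 : gaussianReal 0 w = (gaussianReal 0 1).map (fun x => √(w : ℝ) * x) := by
    rw [gaussianReal_map_const_mul]
    simp only [mul_zero, mul_one]
    congr 1
    ext
    simp
  have hm : Measurable (fun x : ℝ => x ^ 2) := by fun_prop
  have h2 : eLpNorm (fun ω => Y ω ^ 2) q P = eLpNorm (fun x : ℝ => x ^ 2) q (P.map Y) := by
    rw [eLpNorm_map_measure hm.aestronglyMeasurable hY.aemeasurable]
    rfl
  rw [h2, hlaw, h1, eLpNorm_map_measure hm.aestronglyMeasurable (by fun_prop)]
  have h3 : ((fun x : ℝ => x ^ 2) ∘ fun x => √(w : ℝ) * x)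
      = (w : ℝ) • (fun x : ℝ => x ^ 2) := by
    ext x
    simp [mul_pow]
  rw [h3, eLpNorm_const_smul, gaussianSqNorm]
  congr 1
  simp [enorm_eq_nnnorm]

variable {H : Type*} [NormedAddCommGroup H] [InnerProductSpace ℝ H]

theorem inner_sum_smul_eq (g : ℕ → ℝ) (c : ℕ → H) (x : H) (n : ℕ) :
    inner ℝ x (∑ i ∈ Finset.range n, g i • c i)
      = ∑ i ∈ Finset.range n, inner ℝ x (c i) * g i := by
  rw [inner_sum]
  exact Finset.sum_congr rfl fun i _ => by rw [inner_smul_right, mul_comm]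

/-- Moments of finitely many coordinates of a Gaussian vector. -/
theorem eLpNorm_sum_inner_sq_le [IsProbabilityMeasure P] {g : ℕ → Ω → ℝ}
    (hg : ∀ i, Measurable (g i))
    (hind : iIndepFun g P) {v : ℝ≥0} (hlaw : ∀ i, P.map (g i) = gaussianReal 0 v)
    {e : ℕ → H} (he : Orthonormal ℝ e) (s : Finset ℕ) (b : ℕ → H) (n : ℕ) {q : ℝ≥0∞}
    (hq : 1 ≤ q) :
    eLpNorm (fun ω => ∑ k ∈ s, inner ℝ (e k) (∑ i ∈ Finset.range n, g i ω • b i) ^ 2) q P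
      ≤ ENNReal.ofReal (v * ∑ i ∈ Finset.range n, ‖b i‖ ^ 2) * gaussianSqNorm q := by
  have hY : ∀ k, (fun ω => inner ℝ (e k) (∑ i ∈ Finset.range n, g i ω • b i))
      = fun ω => ∑ i ∈ Finset.range n, inner ℝ (e k) (b i) * g i ω := fun k => by
    ext ω
    exact inner_sum_smul_eq (fun i => g i ω) b (e k) n
  have hYm : ∀ k, Measurable
      (fun ω => inner ℝ (e k) (∑ i ∈ Finset.range n, g i ω • b i)) := fun k => by
    rw [hY]
    exact Finset.measurable_fun_sum _ fun i _ => (hg i).const_mul _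
  have hsum : (fun ω => ∑ k ∈ s, inner ℝ (e k) (∑ i ∈ Finset.range n, g i ω • b i) ^ 2)
      = ∑ k ∈ s, fun ω => inner ℝ (e k) (∑ i ∈ Finset.range n, g i ω • b i) ^ 2 := by
    ext ω; simp
  rw [hsum]
  -- Minkowski over the coordinates needs no independence between them. The variances then add up to
  -- at most `v ∑ ‖b i‖²` by Bessel, whatever the size of `s`.
  refine (eLpNorm_sum_le (fun k _ => ((hYm k).pow_const 2).aestronglyMeasurable) hq).trans ?_
  have hk : ∀ k ∈ s, eLpNorm (fun ω => inner ℝ (e k) (∑ i ∈ Finset.range n, g i ω • b i) ^ 2) q P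
      = ENNReal.ofReal (v * ∑ i ∈ Finset.range n, inner ℝ (e k) (b i) ^ 2)
        * gaussianSqNorm q := fun k _ => by
    rw [eLpNorm_sq_of_map_eq_gaussianReal (hYm k)
      (by rw [hY]; exact map_sum_mul_gaussianReal hg hind hlaw _ n)]
    congr 1
    rw [← ENNReal.ofReal_coe_nnreal]
    simp
  rw [Finset.sum_congr rfl hk, ← Finset.sum_mul,
    ← ENNReal.ofReal_sum_of_nonneg (f := fun k => (v : ℝ) * ∑ i ∈ Finset.range n,
      inner ℝ (e k) (b i) ^ 2) fun k _ => by positivity]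
  gcongr
  rw [← Finset.mul_sum, Finset.sum_comm]
  gcongr with i _
  simpa using he.sum_inner_products_le (b i) (s := s)

end GaussianMoments

/-! ### Second order expansion of powers. -/

section Elementary

theorem abs_one_add_pow_sub_le (z : ℝ) (n : ℕ) :
    |(1 + z) ^ n - 1 - n * z| ≤ n ^ 2 * (z ^ 2 * (1 + |z|) ^ n) := by
  induction n with
  | zero => simp
  | succ n ih =>
    have h1 : (1 + z) ^ (n + 1) - 1 - (n + 1 : ℕ) * z
        = (1 + z) * ((1 + z) ^ n - 1 - n * z) + n * z ^ 2 := by push_cast; ring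
    have h2 : |1 + z| ≤ 1 + |z| := by simpa using abs_add_le 1 z
    have h3 : (1 : ℝ) ≤ (1 + |z|) ^ (n + 1) := one_le_pow₀ (by linarith [abs_nonneg z])
    rw [h1]
    calc _ ≤ |(1 + z) * ((1 + z) ^ n - 1 - n * z)| + |n * z ^ 2| := abs_add_le _ _
      _ = |1 + z| * |(1 + z) ^ n - 1 - n * z| + n * z ^ 2 := by
        rw [abs_mul, abs_of_nonneg (by positivity : (0 : ℝ) ≤ n * z ^ 2)]
      _ ≤ (1 + |z|) * (n ^ 2 * (z ^ 2 * (1 + |z|) ^ n))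
          + n * z ^ 2 * (1 + |z|) ^ (n + 1) := by
        exact add_le_add (mul_le_mul h2 ih (abs_nonneg _) (by positivity))
          (le_mul_of_one_le_right (by positivity) h3)
      _ = (n ^ 2 + n) * (z ^ 2 * (1 + |z|) ^ (n + 1)) := by ring
      _ ≤ _ := by
        push_cast
        gcongr
        nlinarith [(Nat.cast_nonneg n : (0 : ℝ) ≤ n)]

/-- Second order expansion of a power of a perturbation of one of size `√τ`. -/
theorem one_add_noise_pow_le {K τ T θ r w : ℝ} (hK : 0 ≤ K) (hτ : 0 ≤ τ) (hT : τ ≤ T)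
    (hθ : |θ| ≤ K) (hr : 0 ≤ r) (hw : w ^ 2 ≤ r) (n : ℕ) :
    (1 + K * τ + K * τ * r + θ * √τ * w) ^ n ≤ 1 + n * θ * √τ * w
      + τ * (n * K + n ^ 2 * ((K * √T + K) ^ 2 * (1 + √T * (K * √T + K)) ^ n))
        * (1 + r) ^ (n + 2) := by
  set M := K * √T + K with hM
  set y := K * √τ * (1 + r) + θ * w with hy
  -- The whole perturbation is `√τ * y` with `|y| ≤ M (1 + r)`, so the quadratic remainder `z² (1 +
  -- |z|)^n` carries a factor `τ` and at most `n + 2` powers of `1 + r`.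
  set z := √τ * y with hz
  have hsq : √τ * √τ = τ := Real.mul_self_sqrt hτ
  have hzz : K * τ + K * τ * r + θ * √τ * w = z := by
    rw [hz, hy]; nth_rewrite 1 [← hsq]; nth_rewrite 3 [← hsq]; ring
  have hw1 : |w| ≤ 1 + r := abs_le_of_sq_le_sq (by nlinarith) (by linarith)
  have hM0 : 0 ≤ M := by positivity
  have hyle : |y| ≤ M * (1 + r) := by
    calc |y| ≤ |K * √τ * (1 + r)| + |θ * w| := abs_add_le _ _
      _ = K * √τ * (1 + r) + |θ| * |w| := by
        rw [abs_of_nonneg (by positivity), abs_mul]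
      _ ≤ K * √T * (1 + r) + K * (1 + r) := by gcongr
      _ = M * (1 + r) := by rw [hM]; ring
  have hz2 : z ^ 2 ≤ τ * (M ^ 2 * (1 + r) ^ 2) := by
    rw [hz, mul_pow, Real.sq_sqrt hτ, ← mul_pow, ← sq_abs y]
    gcongr
  have hz1 : 1 + |z| ≤ (1 + √T * M) * (1 + r) := by
    rw [hz, abs_mul, abs_of_nonneg (Real.sqrt_nonneg τ)]
    have : √τ * |y| ≤ √T * (M * (1 + r)) := by gcongr
    nlinarith
  have hmain := (abs_le.1 (abs_one_add_pow_sub_le z n)).2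
  have h1r : (1 : ℝ) ≤ 1 + r := by linarith
  have hb : z ^ 2 * (1 + |z|) ^ n ≤ τ * (M ^ 2 * (1 + √T * M) ^ n) * (1 + r) ^ (n + 2) := by
    calc z ^ 2 * (1 + |z|) ^ n
        ≤ τ * (M ^ 2 * (1 + r) ^ 2) * ((1 + √T * M) * (1 + r)) ^ n := by gcongr
      _ = _ := by rw [mul_pow]; ring
  have hpow : 1 + r ≤ (1 + r) ^ (n + 2) := le_self_pow₀ h1r (by omega)
  have hlin : n * (K * τ + K * τ * r) ≤ τ * (n * K) * (1 + r) ^ (n + 2) := by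
    calc n * (K * τ + K * τ * r) = τ * (n * K) * (1 + r) := by ring
      _ ≤ _ := by gcongr
  have e1 : (1 + K * τ + K * τ * r + θ * √τ * w) = 1 + z := by rw [← hzz]; ring
  have e2 : (n : ℝ) * z = n * (K * τ + K * τ * r) + n * θ * √τ * w := by rw [← hzz]; ring
  have hn2 : (n : ℝ) ^ 2 * (z ^ 2 * (1 + |z|) ^ n)
      ≤ n ^ 2 * (τ * (M ^ 2 * (1 + √T * M) ^ n) * (1 + r) ^ (n + 2)) := by gcongr
  rw [e1]
  calc (1 + z) ^ n ≤ 1 + n * z + n ^ 2 * (z ^ 2 * (1 + |z|) ^ n) := by linarith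
    _ ≤ 1 + (τ * (n * K) * (1 + r) ^ (n + 2) + n * θ * √τ * w)
        + n ^ 2 * (τ * (M ^ 2 * (1 + √T * M) ^ n) * (1 + r) ^ (n + 2)) := by
      rw [e2]; gcongr
    _ = _ := by ring

end Elementary

/-! ### Growth of moments over one Gaussian increment. -/

section NoiseStep

variable {Ω : Type*} {mΩ : MeasurableSpace Ω} {P : Measure Ω}
variable {H : Type*} [NormedAddCommGroup H] [InnerProductSpace ℝ H]

/-- Constant in the growth of the moments of order `n` in one time step. -/
noncomputable def growthConst (K T : ℝ) (n : ℕ) : ℝ :=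
  (n * K + n ^ 2 * ((K * √T + K) ^ 2 * (1 + √T * (K * √T + K)) ^ n))
    * (1 + K * (gaussianSqNorm ((n + 2 : ℕ) : ℝ≥0∞)).toReal) ^ (n + 2)

theorem growthConst_nonneg {K T : ℝ} (hK : 0 ≤ K) (n : ℕ) : 0 ≤ growthConst K T n := by
  unfold growthConst
  positivity

theorem lintegral_ofReal_pow_le_of_eLpNorm_le {f : Ω → ℝ} (hf0 : ∀ ω, 0 ≤ f ω) {q : ℕ}
    (hq : q ≠ 0) {M : ℝ} (hM : 0 ≤ M) (h : eLpNorm f q P ≤ ENNReal.ofReal M) :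
    ∫⁻ ω, ENNReal.ofReal (f ω ^ q) ∂P ≤ ENNReal.ofReal (M ^ q) := by
  rw [eLpNorm_eq_lintegral_rpow_enorm_toReal (by simpa using hq) (by simp)] at h
  have h2 := ENNReal.rpow_le_rpow h (z := (q : ℝ)) (by positivity)
  rw [← ENNReal.rpow_mul] at h2
  simp only [ENNReal.toReal_natCast, ENNReal.rpow_natCast] at h2
  rw [one_div_mul_cancel (by exact_mod_cast hq), ENNReal.rpow_one,
    ← ENNReal.ofReal_pow hM] at h2
  refine le_trans (lintegral_mono fun ω => ?_) h2
  rw [Real.enorm_eq_ofReal (hf0 ω), ENNReal.ofReal_pow (hf0 ω)]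

/-- Growth of moments under a Gaussian perturbation with deterministic coefficients. -/
theorem lintegral_noise_pow_le [IsProbabilityMeasure P] {g : ℕ → Ω → ℝ}
    (hg : ∀ i, Measurable (g i)) (hind : iIndepFun g P) {τ : ℝ≥0} (hτ : 0 < τ)
    (hlaw : ∀ i, P.map (g i) = gaussianReal 0 τ)
    {e : ℕ → H} (he : Orthonormal ℝ e) (s : Finset ℕ) (b : ℕ → H) (v : H) {K T θ V : ℝ}
    (hK : 0 ≤ K) (hT : τ ≤ T) (hθ : |θ| ≤ K) (hV : 0 < V) (hv : ‖v‖ ^ 2 ≤ V) (n : ℕ)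
    (hb : ∑ i ∈ Finset.range n, ‖b i‖ ^ 2 ≤ K * V) {m : ℕ} (hm : Even m) :
    ∫⁻ ω, ENNReal.ofReal (((1 + K * τ) * V
        + K * ∑ k ∈ s, inner ℝ (e k) (∑ i ∈ Finset.range n, g i ω • b i) ^ 2
        + θ * ∑ k ∈ s, inner ℝ (e k) (∑ i ∈ Finset.range n, g i ω • b i) * inner ℝ (e k) v) ^ m) ∂P
      ≤ ENNReal.ofReal ((1 + growthConst K T m * τ) * V ^ m) := by
  have hτ' : (0 : ℝ) < τ := hτ
  set S : Ω → H := fun ω => ∑ i ∈ Finset.range n, g i ω • b i with hS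
  set Z : Ω → ℝ := fun ω => ∑ k ∈ s, inner ℝ (e k) (S ω) ^ 2 with hZ
  set Y : Ω → ℝ := fun ω => ∑ k ∈ s, inner ℝ (e k) (S ω) * inner ℝ (e k) v with hY
  -- `r` and `w` are the quadratic and linear noise terms, freed of `τ` and `V`. Cauchy–Schwarz
  -- gives `w² ≤ r`, and the moments of `r` are bounded in terms of `K` alone.
  set r : Ω → ℝ := fun ω => (τ * V)⁻¹ * Z ω with hr
  set w : Ω → ℝ := fun ω => (√τ * V)⁻¹ * Y ω with hw
  set q : ℕ := m + 2 with hq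
  set c := (gaussianSqNorm (q : ℝ≥0∞)).toReal with hc
  have hZ0 : ∀ ω, 0 ≤ Z ω := fun ω => Finset.sum_nonneg fun k _ => sq_nonneg _
  have hr0 : ∀ ω, 0 ≤ r ω := fun ω => mul_nonneg (by positivity) (hZ0 ω)
  have hSm : ∀ x : H, Measurable fun ω => inner ℝ x (S ω) := fun x => by
    simp_rw [hS, inner_sum_smul_eq (fun i => g i _) b x n]
    exact Finset.measurable_fun_sum _ fun i _ => (hg i).const_mul _
  have hZm : Measurable Z := Finset.measurable_fun_sum _ fun k _ => (hSm (e k)).pow_const 2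
  have hYm : Measurable Y := Finset.measurable_fun_sum _ fun k _ => (hSm (e k)).mul_const _
  have hYZ : ∀ ω, Y ω ^ 2 ≤ Z ω * V := fun ω => by
    have h1 := Finset.sum_mul_sq_le_sq_mul_sq s (fun k => inner ℝ (e k) (S ω))
      (fun k => inner ℝ (e k) v)
    refine h1.trans (mul_le_mul_of_nonneg_left ?_ (hZ0 ω))
    refine le_trans ?_ hv
    simpa using he.sum_inner_products_le v (s := s)
  have hwr : ∀ ω, w ω ^ 2 ≤ r ω := fun ω => by
    simp only [hw, hr, mul_pow, mul_inv, inv_pow, Real.sq_sqrt hτ'.le]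
    calc _ ≤ (τ : ℝ)⁻¹ * (V ^ 2)⁻¹ * (Z ω * V) := by gcongr; exact hYZ ω
      _ = _ := by field_simp
  -- the linear term
  have hYlin : Y = fun ω => ∑ i ∈ Finset.range n,
      (∑ k ∈ s, inner ℝ (e k) (b i) * inner ℝ (e k) v) * g i ω := by
    ext ω
    simp only [hY, hS, inner_sum_smul_eq (fun i => g i ω) b _ n, Finset.sum_mul]
    rw [Finset.sum_comm]
    exact Finset.sum_congr rfl fun i _ => Finset.sum_congr rfl fun k _ => by ring
  have hYlaw := map_sum_mul_gaussianReal hg hind hlaw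
    (fun i => ∑ k ∈ s, inner ℝ (e k) (b i) * inner ℝ (e k) v) n
  rw [← hYlin] at hYlaw
  have hYint : Integrable Y P := by
    have h1 := (memLp_id_gaussianReal (μ := 0) (v := τ * ∑ i ∈ Finset.range n,
      ‖∑ k ∈ s, inner ℝ (e k) (b i) * inner ℝ (e k) v‖₊ ^ 2) 1)
    rw [← hYlaw] at h1
    have h2 := h1.comp_measurePreserving ⟨hYm, rfl⟩
    exact memLp_one_iff_integrable.1 (by simpa using h2)
  have hY0 : ∫ ω, Y ω ∂P = 0 := by
    have h1 : ∫ ω, Y ω ∂P = ∫ x, id x ∂(P.map Y) := by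
      rw [integral_map hYm.aemeasurable (by fun_prop)]; rfl
    rw [h1, hYlaw]
    exact integral_id_gaussianReal
  -- the quadratic terms
  have hq1 : (1 : ℝ≥0∞) ≤ q := by exact_mod_cast (by omega : 1 ≤ q)
  have hrn : eLpNorm r q P ≤ ENNReal.ofReal (K * c) := by
    have h1 : r = (τ * V)⁻¹ • Z := rfl
    rw [h1, eLpNorm_const_smul]
    refine (mul_le_mul_right (eLpNorm_sum_inner_sq_le hg hind hlaw he s b n hq1) _).trans ?_
    rw [← ENNReal.ofReal_toReal (gaussianSqNorm_lt_top (q : ℝ≥0∞) (by simp)).ne,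
      Real.enorm_eq_ofReal (by positivity), ← ENNReal.ofReal_mul (by positivity),
      ← ENNReal.ofReal_mul (by positivity)]
    apply ENNReal.ofReal_le_ofReal
    calc _ ≤ (τ * V : ℝ)⁻¹ * (τ * (K * V) * c) := by gcongr
      _ = K * c := by field_simp
  have h1rn : eLpNorm (fun ω => 1 + r ω) q P ≤ ENNReal.ofReal (1 + K * c) := by
    have h1 := eLpNorm_add_le (f := fun _ : Ω => (1 : ℝ)) (g := r) (μ := P) (p := q)
      aestronglyMeasurable_const (hZm.const_mul _).aestronglyMeasurable hq1
    refine h1.trans ?_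
    rw [eLpNorm_const _ (by simp [hq]) (NeZero.ne P),
      ENNReal.ofReal_add zero_le_one (by positivity)]
    gcongr
    simp
  have hpow := lintegral_ofReal_pow_le_of_eLpNorm_le (fun ω => by linarith [hr0 ω])
    (by simp [hq]) (by positivity) h1rn
  have hpm : Measurable fun ω => (1 + r ω) ^ q :=
    (measurable_const.add (hZm.const_mul _)).pow_const q
  have hpow0 : ∀ ω, 0 ≤ (1 + r ω) ^ q := fun ω => pow_nonneg (by linarith [hr0 ω]) _
  have hpint : Integrable (fun ω => (1 + r ω) ^ q) P := by
    refine ⟨hpm.aestronglyMeasurable, ?_⟩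
    rw [hasFiniteIntegral_iff_ofReal (Eventually.of_forall hpow0)]
    exact hpow.trans_lt ENNReal.ofReal_lt_top
  have hpI : ∫ ω, (1 + r ω) ^ q ∂P ≤ (1 + K * c) ^ q := by
    rw [← ofReal_integral_eq_lintegral_ofReal hpint (Eventually.of_forall hpow0)] at hpow
    exact (ENNReal.ofReal_le_ofReal_iff (by positivity)).1 hpow
  -- conclusion
  set C0 := m * K + m ^ 2 * ((K * √T + K) ^ 2 * (1 + √T * (K * √T + K)) ^ m) with hC0
  have hC0' : 0 ≤ C0 := by positivity
  -- `R` dominates the integrand pointwise and isolates the only term of order `√τ`; that term is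
  -- linear in `w` and has mean zero.
  set R : Ω → ℝ := fun ω => V ^ m * (1 + m * θ * √τ * w ω + τ * C0 * (1 + r ω) ^ q) with hR
  have hsτ : 0 < √(τ : ℝ) := Real.sqrt_pos.2 hτ'
  have hle : ∀ ω, ((1 + K * τ) * V + K * Z ω + θ * Y ω) ^ m ≤ R ω := fun ω => by
    have h1 : (1 + K * τ) * V + K * Z ω + θ * Y ω
        = V * (1 + K * τ + K * τ * r ω + θ * √τ * w ω) := by
      simp only [hr, hw]
      field_simp
    rw [h1, mul_pow]
    exact mul_le_mul_of_nonneg_left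
      (one_add_noise_pow_le hK hτ'.le hT hθ (hr0 ω) (hwr ω) m) (by positivity)
  have hwint : Integrable w P := hYint.const_mul _
  have hw0 : ∫ ω, w ω ∂P = 0 := by
    rw [hw, integral_const_mul, hY0, mul_zero]
  have hi1 : Integrable (fun ω => m * θ * √τ * w ω) P := hwint.const_mul _
  have hi2 : Integrable (fun ω => τ * C0 * (1 + r ω) ^ q) P := hpint.const_mul _
  have hi3 : Integrable (fun ω => 1 + m * θ * √τ * w ω) P := (integrable_const _).add hi1
  have hRint : Integrable R P := (hi3.add hi2).const_mul _
  have hRI : ∫ ω, R ω ∂P ≤ (1 + growthConst K T m * τ) * V ^ m := by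
    simp only [hR]
    rw [integral_const_mul, integral_add hi3 hi2, integral_add (integrable_const _) hi1,
      integral_const_mul (m * θ * √τ), integral_const_mul (τ * C0), hw0]
    simp only [integral_const, probReal_univ, smul_eq_mul, mul_one, mul_zero, add_zero]
    have h1 : τ * C0 * ∫ ω, (1 + r ω) ^ q ∂P ≤ growthConst K T m * τ :=
      calc _ ≤ τ * C0 * (1 + K * c) ^ q := by gcongr
        _ = growthConst K T m * τ := by rw [growthConst]; ring
    rw [mul_comm]
    exact mul_le_mul_of_nonneg_right (by linarith) (by positivity)
  -- The base of the power may be negative; evenness of `m` is what gives `R ≥ 0`, so that the lower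
  -- integral is the Bochner integral.
  have hR0 : ∀ ω, 0 ≤ R ω := fun ω => (hm.pow_nonneg _).trans (hle ω)
  calc _ ≤ ∫⁻ ω, ENNReal.ofReal (R ω) ∂P :=
        lintegral_mono fun ω => ENNReal.ofReal_le_ofReal (hle ω)
    _ = ENNReal.ofReal (∫ ω, R ω ∂P) :=
        (ofReal_integral_eq_lintegral_ofReal hRint (Eventually.of_forall hR0)).symm
    _ ≤ _ := ENNReal.ofReal_le_ofReal hRI

/-- Fubini's theorem for functions of a variable measurable with respect to the past and of
variables independent of it. -/
theorem lintegral_comp_eq_lintegral_lintegral {Ω : Type*} {ℱ mΩ : MeasurableSpace Ω}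
    {P : Measure Ω} [IsProbabilityMeasure P] {E : Type*} [MeasurableSpace E]
    (hℱ : ℱ ≤ mΩ) {g : ℕ → Ω → ℝ} (hg : ∀ i, Measurable (g i))
    (hpast : Indep (⨆ i, MeasurableSpace.comap (g i) inferInstance) ℱ P)
    {U : Ω → E} (hU : Measurable[ℱ] U) {Φ : E × (ℕ → ℝ) → ℝ≥0∞} (hΦ : Measurable Φ) :
    ∫⁻ ω, Φ (U ω, fun i => g i ω) ∂P = ∫⁻ ω, ∫⁻ ω', Φ (U ω, fun i => g i ω') ∂P ∂P := by
  have hU' : Measurable U := hU.mono hℱ le_rfl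
  have hG : Measurable fun ω i => g i ω := measurable_pi_lambda _ hg
  have hind : IndepFun U (fun ω i => g i ω) P := by
    refine (indep_of_indep_of_le_left (indep_of_indep_of_le_right hpast ?_) ?_).symm
    · exact hU.comap_le
    -- The σ-algebra generated by the whole sequence is the supremum of those generated by its
    -- entries.
    · rw [MeasurableSpace.pi, MeasurableSpace.comap_iSup]
      refine iSup_mono fun i => ?_
      rw [MeasurableSpace.comap_comp]
      rfl
  have h1 := (indepFun_iff_map_prod_eq_prod_map_map hU'.aemeasurable hG.aemeasurable).1 hind
  have : IsProbabilityMeasure (P.map fun ω i => g i ω) :=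
    Measure.isProbabilityMeasure_map hG.aemeasurable
  rw [← lintegral_map (f := Φ) hΦ (hU'.prodMk hG), h1, lintegral_prod _ hΦ.aemeasurable,
    lintegral_map hΦ.lintegral_prod_right' hU']
  refine lintegral_congr fun ω => ?_
  exact lintegral_map (hΦ.comp measurable_prodMk_left) hG

/-- Growth of the moments in one time step of a scheme driven by Gaussian noise. -/
theorem lintegral_step_pow_le {Ω : Type*} {ℱ mΩ : MeasurableSpace Ω}
    {P : Measure Ω} [IsProbabilityMeasure P] [MeasurableSpace H] [BorelSpace H]
    [SecondCountableTopology H] (hℱ : ℱ ≤ mΩ) {g : ℕ → Ω → ℝ}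
    (hg : ∀ i, Measurable (g i)) (hind : iIndepFun g P) {τ : ℝ≥0} (hτ : 0 < τ)
    (hlaw : ∀ i, P.map (g i) = gaussianReal 0 τ)
    (hpast : Indep (⨆ i, MeasurableSpace.comap (g i) inferInstance) ℱ P)
    {e : ℕ → H} (he : Orthonormal ℝ e) (s : Finset ℕ)
    {U : Ω → H} (hU : Measurable[ℱ] U) {b : ℕ → H → H} (hbc : ∀ i, Continuous (b i))
    {K T θ L : ℝ} (hK : 0 ≤ K) (hT : τ ≤ T) (hθ : |θ| ≤ K) (hL : 1 ≤ L)
    (hb : ∀ v n, ∑ i ∈ Finset.range n, ‖b i v‖ ^ 2 ≤ K * (1 + ‖v‖ ^ 2))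
    {X : Ω → H} (hX : TendstoInMeasure P
      (fun n ω => ∑ i ∈ Finset.range n, g i ω • b i (U ω)) atTop X)
    {m : ℕ} (hm : Even m) {U' : Ω → H}
    (hU' : ∀ᵐ ω ∂P, L + ‖U' ω‖ ^ 2 ≤ (1 + K * τ) * (L + ‖U ω‖ ^ 2)
      + K * ∑ k ∈ s, inner ℝ (e k) (X ω) ^ 2
      + θ * ∑ k ∈ s, inner ℝ (e k) (X ω) * inner ℝ (e k) (U ω)) :
    ∫⁻ ω, ENNReal.ofReal ((L + ‖U' ω‖ ^ 2) ^ m) ∂P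
      ≤ ENNReal.ofReal (1 + growthConst K T m * τ)
        * ∫⁻ ω, ENNReal.ofReal ((L + ‖U ω‖ ^ 2) ^ m) ∂P := by
  set Ψ : H → H → ℝ := fun v x => (1 + K * τ) * (L + ‖v‖ ^ 2)
      + K * ∑ k ∈ s, inner ℝ (e k) x ^ 2
      + θ * ∑ k ∈ s, inner ℝ (e k) x * inner ℝ (e k) v with hΨ
  have hΨc : Continuous fun z : H × H => Ψ z.1 z.2 := by
    simp only [hΨ]
    fun_prop
  -- `X` is only a limit in probability of the partial sums. The bound is proved for each partial
  -- sum with a constant independent of `n`, then passed to an almost surely convergent subsequence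
  -- by Fatou.
  obtain ⟨ns, -, hns⟩ := hX.exists_seq_tendsto_ae
  set Φ : ℕ → H × (ℕ → ℝ) → ℝ≥0∞ := fun n z =>
    ENNReal.ofReal (Ψ z.1 (∑ i ∈ Finset.range n, z.2 i • b i z.1) ^ m) with hΦ
  have hΦm : ∀ n, Measurable (Φ n) := fun n => by
    have hc : Continuous fun z : H × (ℕ → ℝ) => ∑ i ∈ Finset.range n, z.2 i • b i z.1 := by
      refine continuous_finsetSum _ fun i _ => ?_
      exact ((continuous_apply i).comp continuous_snd).smul ((hbc i).comp continuous_fst)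
    exact (ENNReal.continuous_ofReal.comp
      ((hΨc.comp (continuous_fst.prodMk hc)).pow m)).measurable
  have hUm : Measurable U := hU.mono hℱ le_rfl
  have hG : Measurable fun ω i => g i ω := measurable_pi_lambda _ hg
  have hone : ∀ n, ∫⁻ ω, Φ n (U ω, fun i => g i ω) ∂P
      ≤ ENNReal.ofReal (1 + growthConst K T m * τ)
        * ∫⁻ ω, ENNReal.ofReal ((L + ‖U ω‖ ^ 2) ^ m) ∂P := fun n => by
    -- Freezing `U ω` makes the coefficients `b i (U ω)` deterministic, which reduces the claim to
    -- the Gaussian case.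
    rw [lintegral_comp_eq_lintegral_lintegral hℱ hg hpast hU (hΦm n),
      ← lintegral_const_mul' _ _ ENNReal.ofReal_ne_top]
    refine lintegral_mono fun ω => ?_
    have h0 : 0 ≤ growthConst K T m := growthConst_nonneg hK m
    rw [← ENNReal.ofReal_mul (by positivity)]
    refine lintegral_noise_pow_le hg hind hτ hlaw he s (fun i => b i (U ω)) (U ω) hK hT hθ
      (by positivity) (by linarith) n ((hb (U ω) n).trans ?_) hm
    gcongr
  calc ∫⁻ ω, ENNReal.ofReal ((L + ‖U' ω‖ ^ 2) ^ m) ∂P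
      ≤ ∫⁻ ω, liminf (fun k => Φ (ns k) (U ω, fun i => g i ω)) atTop ∂P := by
        refine lintegral_mono_ae ?_
        filter_upwards [hU', hns] with ω h1 h2
        have h3 : Tendsto (fun k => Φ (ns k) (U ω, fun i => g i ω)) atTop
            (𝓝 (ENNReal.ofReal (Ψ (U ω) (X ω) ^ m))) := by
          have h4 : Continuous fun x => ENNReal.ofReal (Ψ (U ω) x ^ m) :=
            ENNReal.continuous_ofReal.comp
              ((hΨc.comp (continuous_const.prodMk continuous_id)).pow m)
          exact (h4.tendsto _).comp h2
        rw [h3.liminf_eq]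
        exact ENNReal.ofReal_le_ofReal (pow_le_pow_left₀ (by positivity) h1 m)
    _ ≤ liminf (fun k => ∫⁻ ω, Φ (ns k) (U ω, fun i => g i ω) ∂P) atTop :=
        lintegral_liminf_le fun k => (hΦm _).comp (hUm.prodMk hG)
    _ ≤ _ := by
        refine liminf_le_of_frequently_le' (Eventually.frequently ?_)
        exact Eventually.of_forall fun k => hone _

end NoiseStep

/-! ### The projection `P^N` and the deterministic stability of one step. -/

section Galerkin

variable {d : ℕ} {D : Set (EuclideanSpace ℝ (Fin d))}

theorem inner_galerkinProj (e : HilbertBasis ℕ ℝ (L2 D)) (N : ℕ) (x y : L2 D) :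
    inner ℝ (galerkinProj e N x) y
      = ∑ k ∈ Finset.range (N + 1), inner ℝ (e k) x * inner ℝ (e k) y := by
  rw [galerkinProj, sum_inner]
  exact Finset.sum_congr rfl fun k _ => by rw [inner_smul_left]; rfl

theorem inner_galerkinProj_of_le (e : HilbertBasis ℕ ℝ (L2 D)) {N k : ℕ} (hk : k ≤ N) (x : L2 D) :
    inner ℝ (e k) (galerkinProj e N x) = inner ℝ (e k) x := by
  rw [real_inner_comm, inner_galerkinProj]
  rw [Finset.sum_eq_single k]
  · simp [e.orthonormal.1 k]
  · intro j _ hj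
    rw [e.orthonormal.2 hj, mul_zero]
  · intro h
    simp at h
    omega

theorem norm_galerkinProj_sq (e : HilbertBasis ℕ ℝ (L2 D)) (N : ℕ) (x : L2 D) :
    ‖galerkinProj e N x‖ ^ 2 = ∑ k ∈ Finset.range (N + 1), inner ℝ (e k) x ^ 2 := by
  rw [← real_inner_self_eq_norm_sq, inner_galerkinProj]
  refine Finset.sum_congr rfl fun k hk => ?_
  rw [inner_galerkinProj_of_le e (by simp at hk; omega), sq]

theorem norm_galerkinProj_le (e : HilbertBasis ℕ ℝ (L2 D)) (N : ℕ) (x : L2 D) :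
    ‖galerkinProj e N x‖ ≤ ‖x‖ := by
  refine le_of_sq_le_sq ?_ (norm_nonneg _)
  rw [norm_galerkinProj_sq]
  simpa using e.orthonormal.sum_inner_products_le x (s := Finset.range (N + 1))

theorem galerkinProj_of_mem (e : HilbertBasis ℕ ℝ (L2 D)) {N : ℕ} {x : L2 D}
    (hx : x ∈ Submodule.span ℝ (e '' Set.Iic N)) : galerkinProj e N x = x := by
  induction hx using Submodule.span_induction with
  | mem x hx =>
    obtain ⟨k, hk, rfl⟩ := hx
    rw [galerkinProj, Finset.sum_eq_single k]
    · simp [e.orthonormal.1 k]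
    · intro j _ hj
      rw [e.orthonormal.2 hj, zero_smul]
    · intro h
      simp at h hk
      omega
  | zero => simp [galerkinProj]
  | add x y _ _ hx hy =>
    nth_rewrite 2 [← hx, ← hy]
    simp [galerkinProj, inner_add_right, add_smul, Finset.sum_add_distrib]
  | smul t x _ hx =>
    nth_rewrite 2 [← hx]
    simp [galerkinProj, inner_smul_right, Finset.smul_sum, smul_smul]

theorem inner_galerkinProj_of_mem (e : HilbertBasis ℕ ℝ (L2 D)) {N : ℕ} {y : L2 D}
    (hy : y ∈ Submodule.span ℝ (e '' Set.Iic N)) (x : L2 D) :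
    inner ℝ (galerkinProj e N x) y = inner ℝ x y := by
  nth_rewrite 2 [← galerkinProj_of_mem e hy]
  rw [inner_galerkinProj, real_inner_comm, inner_galerkinProj]
  exact Finset.sum_congr rfl fun k _ => mul_comm _ _

theorem IsLaplacian.inner_self_nonpos {bc : BoundaryCondition d} {u w : L2 D}
    (h : IsLaplacian bc u w) : inner ℝ w u ≤ 0 := by
  obtain ⟨g, hg, hgw⟩ := h
  have h1 := hgw u g hg
  have h2 : 0 ≤ ∑ i, inner ℝ (g i) (g i) := Finset.sum_nonneg fun i _ => real_inner_self_nonneg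
  linarith

/-- Symmetry of the Dirichlet form: test the equation for `u` with `e k`, and that for `e k` with
`u`. -/
theorem IsEigenbasis.inner_laplacian {bc : BoundaryCondition d}
    {e : HilbertBasis ℕ ℝ (L2 D)} {lam : ℕ → ℝ} (he : IsEigenbasis bc e lam) {u w : L2 D}
    (h : IsLaplacian bc u w) (k : ℕ) : inner ℝ (e k) w = -lam k * inner ℝ (e k) u := by
  obtain ⟨g, hg, hgw⟩ := h
  obtain ⟨g', hg', hgw'⟩ := he.eigen k
  have h1 := hgw (e k) g' hg'
  have h2 := hgw' u g hg
  rw [inner_neg_left, inner_smul_left] at h2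
  have h3 : ∑ i, inner ℝ (g i) (g' i) = ∑ i, inner ℝ (g' i) (g i) :=
    Finset.sum_congr rfl fun i _ => real_inner_comm _ _
  rw [real_inner_comm]
  simp at h2
  linarith

/-- Energy inequality for one step of the scheme. -/
theorem energy_step (e : HilbertBasis ℕ ℝ (L2 D)) {N : ℕ} {c α ε τ : ℝ} (hα : 0 ≤ α)
    (hτ : 0 ≤ τ) {a b f x Au : L2 D}
    (ha : a ∈ Submodule.span ℝ (e '' Set.Iic N)) (hf : 0 ≤ inner ℝ f a)
    (hA : inner ℝ Au b ≤ 0)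
    (heq : b = a + τ • (Au + (2 * c) • b) - τ • galerkinProj e N f - (α * τ) • (b - a)
      + ε • galerkinProj e N x) :
    (1 + α * τ - 4 * c * τ) * ‖b‖ ^ 2 ≤ (1 + α * τ) * ‖a‖ ^ 2 + 2 * (τ * (τ * ‖f‖ ^ 2))
      + 2 * (ε ^ 2 * ‖galerkinProj e N x‖ ^ 2) + 2 * ε * inner ℝ (galerkinProj e N x) a := by
  set F := galerkinProj e N f
  set X := galerkinProj e N x
  have hFa : 0 ≤ inner ℝ F a := by rwa [inner_galerkinProj_of_mem e ha]
  have hFn : ‖F‖ ≤ ‖f‖ := norm_galerkinProj_le e N f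
  obtain ⟨w, rfl⟩ : ∃ w, b = a + w := ⟨b - a, by abel⟩
  -- The scheme solved for the increment. Pairing with `a + w` and using `2⟨w, a + w⟩ = ‖a + w‖² -
  -- ‖a‖² + ‖w‖²` produces a spare `‖w‖²`.
  have h1 : (1 + α * τ) • w = τ • Au + (2 * c * τ) • (a + w) - τ • F + ε • X := by
    have h2 : w = τ • (Au + (2 * c) • (a + w)) - τ • F - (α * τ) • w + ε • X := by
      rw [← sub_eq_zero]
      rw [← sub_eq_zero] at heq
      rw [← heq, add_sub_cancel_left]
      abel
    rw [add_smul, one_smul]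
    nth_rewrite 1 [h2]
    module
  have h3 := congrArg (fun z => inner ℝ z (a + w)) h1
  simp only [inner_add_left, inner_sub_left, inner_smul_left, RCLike.conj_to_real] at h3
  -- Each of the two Young inequalities spends `‖w‖²/4`; after doubling they use up exactly the
  -- spare `‖w‖²`.
  have hFw : -(τ * inner ℝ F w) ≤ τ * (τ * ‖f‖ ^ 2) + ‖w‖ ^ 2 / 4 := by
    have h4 : -inner ℝ F w ≤ ‖f‖ * ‖w‖ :=
      (neg_le_abs _).trans ((abs_real_inner_le_norm F w).trans (by gcongr))
    nlinarith [sq_nonneg (τ * ‖f‖ - ‖w‖ / 2)]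
  have hXw : ε * inner ℝ X w ≤ ε ^ 2 * ‖X‖ ^ 2 + ‖w‖ ^ 2 / 4 := by
    have h4 : ε * inner ℝ X w ≤ |ε| * (‖X‖ * ‖w‖) := by
      refine (le_abs_self _).trans ?_
      rw [abs_mul]
      gcongr
      exact abs_real_inner_le_norm X w
    nlinarith [sq_nonneg (|ε| * ‖X‖ - ‖w‖ / 2), sq_abs ε]
  have hn : ‖a + w‖ ^ 2 = ‖a‖ ^ 2 + 2 * inner ℝ a w + ‖w‖ ^ 2 := by
    rw [norm_add_sq_real]
  simp only [inner_add_right, real_inner_self_eq_norm_sq, real_inner_comm w a] at h3 hA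
  have hτA : τ * (inner ℝ Au a + inner ℝ Au w) ≤ 0 := mul_nonpos_of_nonneg_of_nonpos hτ hA
  have hτF : 0 ≤ τ * inner ℝ F a := mul_nonneg hτ hFa
  have hαw : 0 ≤ α * τ * ‖w‖ ^ 2 := by positivity
  have hcomm : inner ℝ w a = inner ℝ a w := real_inner_comm _ _
  rw [hcomm] at h3
  rw [hn]
  linear_combination 2 * h3 + 2 * hτA + 2 * hτF + 2 * hFw + 2 * hXw + hαw

/-- Bound on one step of the scheme through the coordinates. -/
theorem coordinate_step {bc : BoundaryCondition d} (e : HilbertBasis ℕ ℝ (L2 D)) {lam : ℕ → ℝ}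
    (he : IsEigenbasis bc e lam) {N : ℕ} {c α ε τ κ : ℝ}
    (hκ : 0 ≤ κ) (hκle : ∀ k ≤ N, κ ≤ |1 + (α - 2 * c + lam k) * τ|)
    {a b f x Au : L2 D} (hb : b ∈ Submodule.span ℝ (e '' Set.Iic N))
    (hA : IsLaplacian bc b Au)
    (heq : b = a + τ • (Au + (2 * c) • b) - τ • galerkinProj e N f - (α * τ) • (b - a)
      + ε • galerkinProj e N x) :
    κ ^ 2 * ‖b‖ ^ 2 ≤ 3 * ((1 + α * τ) ^ 2 * ‖a‖ ^ 2 + τ * (τ * ‖f‖ ^ 2)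
      + ε ^ 2 * ‖galerkinProj e N x‖ ^ 2) := by
  have hk : ∀ k ∈ Finset.range (N + 1), κ ^ 2 * inner ℝ (e k) b ^ 2
      ≤ 3 * ((1 + α * τ) ^ 2 * inner ℝ (e k) a ^ 2 + τ * (τ * inner ℝ (e k) f ^ 2)
        + ε ^ 2 * inner ℝ (e k) x ^ 2) := fun k hk => by
    have hkN : k ≤ N := by simp at hk; omega
    have h1 := congrArg (fun z => inner ℝ (e k) z) heq
    simp only [inner_add_right, inner_sub_right, inner_smul_right,
      inner_galerkinProj_of_le e hkN, he.inner_laplacian hA k] at h1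
    have h2 : (1 + (α - 2 * c + lam k) * τ) * inner ℝ (e k) b
        = (1 + α * τ) * inner ℝ (e k) a - τ * inner ℝ (e k) f + ε * inner ℝ (e k) x := by
      linarith
    calc κ ^ 2 * inner ℝ (e k) b ^ 2
        ≤ |1 + (α - 2 * c + lam k) * τ| ^ 2 * inner ℝ (e k) b ^ 2 := by
          gcongr; exact hκle k hkN
      _ = ((1 + (α - 2 * c + lam k) * τ) * inner ℝ (e k) b) ^ 2 := by rw [sq_abs]; ring
      _ ≤ _ := by
        rw [h2]
        set p := (1 + α * τ) * inner ℝ (e k) a with hp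
        set q := τ * inner ℝ (e k) f with hq
        set r := ε * inner ℝ (e k) x with hr
        have h3 : (p - q + r) ^ 2 ≤ 3 * (p ^ 2 + q ^ 2 + r ^ 2) := by
          nlinarith [sq_nonneg (p + q), sq_nonneg (p - r), sq_nonneg (q + r)]
        refine h3.trans (le_of_eq ?_)
        rw [hp, hq, hr]; ring
  have hs := Finset.sum_le_sum hk
  rw [← Finset.mul_sum, ← Finset.mul_sum, Finset.sum_add_distrib, Finset.sum_add_distrib,
    ← Finset.mul_sum, ← Finset.mul_sum, ← Finset.mul_sum, ← Finset.mul_sum,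
    ← norm_galerkinProj_sq, ← norm_galerkinProj_sq, ← norm_galerkinProj_sq,
    ← norm_galerkinProj_sq, galerkinProj_of_mem e hb] at hs
  refine hs.trans ?_
  have h1 := norm_galerkinProj_le e N a
  have h2 := norm_galerkinProj_le e N f
  have h3 : τ * (τ * ‖galerkinProj e N f‖ ^ 2) ≤ τ * (τ * ‖f‖ ^ 2) := by
    rw [← mul_assoc, ← mul_assoc]
    have := mul_self_nonneg τ
    gcongr
  gcongr

/-- The nonzero symbols of the implicit step are bounded away from zero. -/
theorem exists_pos_le_abs_symbol {lam : ℕ → ℝ} (hlam : Tendsto lam atTop atTop) (μ : ℝ)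
    {τ : ℝ} (hτ : 0 < τ) :
    ∃ κ > 0, ∀ k, 1 + (μ + lam k) * τ ≠ 0 → κ ≤ |1 + (μ + lam k) * τ| := by
  obtain ⟨k₀, hk₀⟩ := eventually_atTop.1 (hlam.eventually_ge_atTop (-μ))
  -- The clause `κ ≤ 1` is carried along for the tail: from `k₀` on, `μ + lam k ≥ 0` and the symbol
  -- is at least `1`.
  have hfin : ∀ n, ∃ κ > 0, κ ≤ 1 ∧
      ∀ k < n, 1 + (μ + lam k) * τ ≠ 0 → κ ≤ |1 + (μ + lam k) * τ| := by
    intro n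
    induction n with
    | zero => exact ⟨1, one_pos, le_rfl, by simp⟩
    | succ n ih =>
      obtain ⟨κ, h0, h1, h2⟩ := ih
      by_cases hz : 1 + (μ + lam n) * τ = 0
      · refine ⟨κ, h0, h1, fun k hk hne => h2 k ?_ hne⟩
        rcases Nat.lt_succ_iff_lt_or_eq.1 hk with h | rfl
        · exact h
        · exact absurd hz hne
      · refine ⟨min κ |1 + (μ + lam n) * τ|, lt_min h0 (abs_pos.2 hz),
          (min_le_left _ _).trans h1, fun k hk hne => ?_⟩
        rcases Nat.lt_succ_iff_lt_or_eq.1 hk with h | rfl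
        · exact (min_le_left _ _).trans (h2 k h hne)
        · exact min_le_right _ _
  obtain ⟨κ, h0, h1, h2⟩ := hfin k₀
  refine ⟨κ, h0, fun k hne => ?_⟩
  rcases lt_or_ge k k₀ with hk | hk
  · exact h2 k hk hne
  · have h3 : 0 ≤ (μ + lam k) * τ := mul_nonneg (by linarith [hk₀ k hk]) hτ.le
    exact h1.trans ((by linarith : 1 ≤ 1 + (μ + lam k) * τ).trans (le_abs_self _))

/-- For one fixed `τ` a large coefficient of `A` can be written as a multiple of `τ`, at the price
of `1 / τ` in the constant. This is harmless for finitely many values of `τ`. -/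
theorem le_of_coordinate_step {A B F X α τ T ε εmax κ : ℝ} (hα : 0 ≤ α) (hτ : 0 < τ)
    (hτT : τ ≤ T) (hε0 : 0 ≤ ε) (hε : ε ≤ εmax) (hκ : 0 < κ) (hA : 0 ≤ A) (hF : 0 ≤ F)
    (hX : 0 ≤ X)
    (h : κ ^ 2 * B ≤ 3 * ((1 + α * τ) ^ 2 * A + τ * (τ * F) + ε ^ 2 * X)) :
    B ≤ 3 * ((1 + α * T) ^ 2 / τ + 1 + εmax ^ 2) / κ ^ 2 * (τ * A + τ * (τ * F) + X) := by
  rw [div_mul_eq_mul_div, le_div_iff₀ (by positivity), mul_comm]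
  refine h.trans ?_
  rw [mul_assoc]
  have h1 : (1 + α * τ) ^ 2 * A ≤ (1 + α * T) ^ 2 / τ * (τ * A) := by
    rw [← mul_assoc, div_mul_cancel₀ _ hτ.ne']
    gcongr
  have h2 : ε ^ 2 * X ≤ εmax ^ 2 * X := by gcongr
  have h3 : 0 ≤ (1 + α * T) ^ 2 / τ := by positivity
  have h4 : 0 ≤ (1 + α * T) ^ 2 / τ * (τ * (τ * F) + X) := by positivity
  have h5 : 0 ≤ εmax ^ 2 * (τ * A + τ * (τ * F)) := by positivity
  have h6 : 0 ≤ τ * A := by positivity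
  linarith

/-- Division by `G`: since `1 + ατ = G + 4cτ`, the coefficient of `A` becomes `1 + G⁻¹ (4cτ) ≤ 1 +
8cτ`. The coefficient of `Y` is kept exact, since `Y` has no sign. -/
theorem le_of_energy_step {A B F X Y G c α τ ε εmax : ℝ} (hc : 0 ≤ c) (hτ : 0 ≤ τ)
    (hε0 : 0 ≤ ε) (hε : ε ≤ εmax) (hA : 0 ≤ A) (hF : 0 ≤ F) (hX : 0 ≤ X)
    (hG : G = 1 + α * τ - 4 * c * τ) (hG2 : G⁻¹ ≤ 2) (hG0 : 0 < G)
    (h : G * B ≤ (1 + α * τ) * A + 2 * (τ * (τ * F)) + 2 * (ε ^ 2 * X) + 2 * ε * Y) :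
    B ≤ (1 + 8 * c * τ) * A + 4 * (τ * (τ * F)) + 4 * εmax ^ 2 * X + G⁻¹ * (2 * ε) * Y := by
  have h1 : B ≤ G⁻¹ * ((1 + α * τ) * A + 2 * (τ * (τ * F)) + 2 * (ε ^ 2 * X) + 2 * ε * Y) := by
    rwa [le_inv_mul_iff₀ hG0]
  have h2 : G⁻¹ * (1 + α * τ) = 1 + G⁻¹ * (4 * c * τ) := by
    rw [show 1 + α * τ = G + 4 * c * τ by rw [hG]; ring, mul_add, inv_mul_cancel₀ hG0.ne']
  have h3 : G⁻¹ * (4 * c * τ) ≤ 2 * (4 * c * τ) := by gcongr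
  have t1 : G⁻¹ * ((1 + α * τ) * A) ≤ (1 + 8 * c * τ) * A := by
    rw [← mul_assoc, h2]
    exact mul_le_mul_of_nonneg_right (by linarith) hA
  have t2 : G⁻¹ * (2 * (τ * (τ * F))) ≤ 2 * (2 * (τ * (τ * F))) := by gcongr
  have t3 : G⁻¹ * (2 * (ε ^ 2 * X)) ≤ 2 * (2 * (εmax ^ 2 * X)) := by gcongr
  linarith

/-- Stability of one step of the scheme, uniformly in the discretisation parameters. -/
theorem exists_step_bound {bc : BoundaryCondition d} (e : HilbertBasis ℕ ℝ (L2 D))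
    {lam : ℕ → ℝ} (he : IsEigenbasis bc e lam) {c α : ℝ} (hc : 0 ≤ c) (hα : 0 ≤ α)
    (εmax : ℝ) {T : ℝ≥0} (hT : 0 < T) :
    ∃ K : ℝ, 0 ≤ K ∧ ∀ ε : ℝ, 0 ≤ ε → ε ≤ εmax → ∀ (J : ℕ) (τ : ℝ≥0), 1 ≤ J → J * τ = T →
      ∃ θ : ℝ, |θ| ≤ K ∧ ∀ N : ℕ, (∀ k ≤ N, 1 + (α - 2 * c + lam k) * τ ≠ 0) →
        ∀ a b f x Au : L2 D, a ∈ Submodule.span ℝ (e '' Set.Iic N) →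
          b ∈ Submodule.span ℝ (e '' Set.Iic N) → 0 ≤ inner ℝ f a → IsLaplacian bc b Au →
          b = a + (τ : ℝ) • (Au + (2 * c) • b) - (τ : ℝ) • galerkinProj e N f
            - (α * τ) • (b - a) + ε • galerkinProj e N x →
          ‖b‖ ^ 2 ≤ (1 + K * τ) * ‖a‖ ^ 2 + K * (τ * (τ * ‖f‖ ^ 2))
            + K * ‖galerkinProj e N x‖ ^ 2 + θ * inner ℝ (galerkinProj e N x) a := by
  have hκ : ∀ J : ℕ, ∃ κ > 0, 1 ≤ J → ∀ k, 1 + (α - 2 * c + lam k) * (T / J : ℝ) ≠ 0 →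
      κ ≤ |1 + (α - 2 * c + lam k) * (T / J : ℝ)| := fun J => by
    rcases Nat.eq_zero_or_pos J with rfl | hJ
    · exact ⟨1, one_pos, by simp⟩
    · have hT' : (0 : ℝ) < T := hT
      obtain ⟨κ, h0, h1⟩ := exists_pos_le_abs_symbol he.tendsto (α - 2 * c)
        (τ := (T / J : ℝ)) (by positivity)
      exact ⟨κ, h0, fun _ => h1⟩
  choose κ hκ0 hκ1 using hκ
  -- For `J ≥ J₀` one has `4cτ ≤ 1/2`, hence `G ≥ 1/2`. The finitely many remaining `J` are covered
  -- by adding their constants `k1 J` to `K`.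
  obtain ⟨J₀, hJ₀⟩ := exists_nat_ge (8 * c * T)
  set k1 : ℕ → ℝ := fun J =>
    3 * ((1 + α * T) ^ 2 / (T / J) + 1 + εmax ^ 2) / κ J ^ 2 with hk1
  have hk10 : ∀ J, 0 ≤ k1 J := fun J => by positivity
  set K2 : ℝ := 8 * c + 4 + 4 * εmax ^ 2 + 4 * |εmax| with hK2
  have hK20 : 0 ≤ K2 := by positivity
  have hS0 : 0 ≤ ∑ J ∈ Finset.range J₀, k1 J := Finset.sum_nonneg fun J _ => hk10 J
  set K := K2 + ∑ J ∈ Finset.range J₀, k1 J with hK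
  have hKK2 : K2 ≤ K := by linarith
  refine ⟨K, by linarith, fun ε hε0 hε J τ hJ hJτ => ?_⟩
  have hJ0 : (0 : ℝ) < J := by exact_mod_cast hJ
  have hT' : (0 : ℝ) < T := hT
  have hJτ' : (J : ℝ) * τ = T := by exact_mod_cast hJτ
  have hτT : (τ : ℝ) = T / J := by rw [eq_div_iff hJ0.ne', mul_comm, hJτ']
  have hτ0 : (0 : ℝ) < τ := by rw [hτT]; positivity
  have hτle : (τ : ℝ) ≤ T := by
    rw [hτT]; exact div_le_self hT'.le (by exact_mod_cast hJ)
  have hεa : ε ≤ |εmax| := hε.trans (le_abs_self _)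
  rcases lt_or_ge J J₀ with hlt | hge
  -- The coordinate estimate has already squared the noise, so no linear term survives and `θ = 0`.
  · refine ⟨0, by simpa using by linarith, fun N hN a b f x Au ha hb hf hA heq => ?_⟩
    have hstep := coordinate_step e he (hκ0 J).le
      (fun k hk => by have h1 := hκ1 J hJ k; rw [← hτT] at h1; exact h1 (hN k hk)) hb hA heq
    have hkK : k1 J ≤ K := by
      have := Finset.single_le_sum (fun j _ => hk10 j) (Finset.mem_range.2 hlt)
      linarith
    have h3 := le_of_coordinate_step hα hτ0 hτle hε0 hε (hκ0 J) (sq_nonneg ‖a‖)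
      (sq_nonneg ‖f‖) (sq_nonneg ‖galerkinProj e N x‖) hstep
    have h4 : 0 ≤ τ * ‖a‖ ^ 2 + τ * (τ * ‖f‖ ^ 2) + ‖galerkinProj e N x‖ ^ 2 := by positivity
    have h5 : ‖b‖ ^ 2 ≤ K * (τ * ‖a‖ ^ 2 + τ * (τ * ‖f‖ ^ 2) + ‖galerkinProj e N x‖ ^ 2) := by
      refine h3.trans (mul_le_mul_of_nonneg_right ?_ h4)
      rw [hτT]
      exact hkK
    linarith [sq_nonneg ‖a‖]
  · have hcτ : 4 * c * τ ≤ 1 / 2 := by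
      have h1 : 8 * c * (J * τ) ≤ J := by
        rw [hJτ']; exact hJ₀.trans (by exact_mod_cast hge)
      nlinarith
    have hατ : 0 ≤ α * τ := by positivity
    set G := 1 + α * τ - 4 * c * τ with hG
    have hG2 : 1 / 2 ≤ G := by linarith
    have hG0 : 0 < G := by linarith
    have hGinv : G⁻¹ ≤ 2 := by
      rw [inv_le_comm₀ hG0 two_pos]; linarith
    refine ⟨G⁻¹ * (2 * ε), ?_, fun N hN a b f x Au ha hb hf hA heq => ?_⟩
    · have hGi0 : 0 < G⁻¹ := by positivity
      rw [abs_of_nonneg (by positivity)]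
      have h1 : G⁻¹ * (2 * ε) ≤ 2 * (2 * |εmax|) := by gcongr
      linarith [sq_nonneg εmax]
    · have h1 := le_of_energy_step hc hτ0.le hε0 hε (sq_nonneg ‖a‖) (sq_nonneg ‖f‖)
        (sq_nonneg ‖galerkinProj e N x‖) hG hGinv hG0
        (energy_step e hα hτ0.le ha hf hA.inner_self_nonpos heq)
      have hεa0 := abs_nonneg εmax
      have hε20 := sq_nonneg εmax
      have h2 : 8 * c * τ ≤ K * τ := mul_le_mul_of_nonneg_right (by linarith) hτ0.le
      have t1 := mul_le_mul_of_nonneg_right h2 (sq_nonneg ‖a‖)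
      have t2 := mul_le_mul_of_nonneg_right (by linarith : 4 ≤ K)
        (by positivity : 0 ≤ τ * (τ * ‖f‖ ^ 2))
      have t3 := mul_le_mul_of_nonneg_right (by linarith : 4 * εmax ^ 2 ≤ K)
        (sq_nonneg ‖galerkinProj e N x‖)
      linarith

end Galerkin

/-! ### Superposition operators on a bounded domain. -/

section Domain

variable {d : ℕ} {D : Set (EuclideanSpace ℝ (Fin d))}

theorem BoundaryCondition.Admissible.isBounded {bc : BoundaryCondition d}
    (h : bc.Admissible D) : Bornology.IsBounded D := by
  match bc with
  | .neumann => exact h.2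
  | .periodic a L =>
    obtain ⟨-, rfl⟩ := h
    have h1 : Bornology.IsBounded (Set.pi Set.univ fun i => Set.Icc (a i) (a i + L i)) :=
      Bornology.IsBounded.pi fun i => Metric.isBounded_Icc _ _
    have h2 := (EuclideanSpace.equiv (Fin d) ℝ).symm.lipschitz.isBounded_image h1
    refine h2.subset fun x hx => ⟨EuclideanSpace.equiv (Fin d) ℝ x, fun i _ => ?_, by simp⟩
    exact ⟨(hx i).1.le, (hx i).2.le⟩

theorem isFiniteMeasure_restrict (hD : Bornology.IsBounded D) :
    IsFiniteMeasure (volume.restrict D) :=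
  ⟨by simpa using hD.measure_lt_top⟩

theorem coeFn_superpose (hD : Bornology.IsBounded D) {g : ℝ → ℝ} (hg : Continuous g) {M : ℝ}
    (hM : ∀ x, |g x| ≤ M) (v : L2 D) :
    superpose g v =ᵐ[volume.restrict D] fun x => g (v x) := by
  have h := memLp_comp hD hg hM v
  rw [superpose, dif_pos h]
  exact h.coeFn_toLp

/-- The square root of the volume of the domain. -/
noncomputable def domainConst (D : Set (EuclideanSpace ℝ (Fin d))) : ℝ :=
  (measureUnivNNReal (volume.restrict D) ^ (2 : ℝ≥0∞).toReal⁻¹ : ℝ≥0)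

theorem domainConst_nonneg : 0 ≤ domainConst D := NNReal.coe_nonneg _

theorem norm_superpose_le (hD : Bornology.IsBounded D) {g : ℝ → ℝ} (hg : Continuous g) {M : ℝ}
    (hM : ∀ x, |g x| ≤ M) (v : L2 D) : ‖superpose g v‖ ≤ domainConst D * M := by
  have := isFiniteMeasure_restrict hD
  have hM0 : 0 ≤ M := (abs_nonneg _).trans (hM 0)
  refine Lp.norm_le_of_ae_bound hM0 ?_
  filter_upwards [coeFn_superpose hD hg hM v] with x hx
  rw [hx]
  exact hM _

theorem continuous_superpose (hD : Bornology.IsBounded D) {g : ℝ → ℝ} {K : ℝ≥0}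
    (hg : LipschitzWith K g) {M : ℝ} (hM : ∀ x, |g x| ≤ M) :
    Continuous (superpose g : L2 D → L2 D) := by
  refine LipschitzWith.continuous (K := K) (LipschitzWith.of_dist_le_mul fun u v => ?_)
  rw [dist_eq_norm, dist_eq_norm]
  refine Lp.norm_le_mul_norm_of_ae_le_mul ?_
  filter_upwards [coeFn_superpose hD hg.continuous hM u, coeFn_superpose hD hg.continuous hM v,
    Lp.coeFn_sub u v, Lp.coeFn_sub (superpose g u) (superpose g v)] with x h1 h2 h3 h4
  rw [h3, h4, Pi.sub_apply, Pi.sub_apply, h1, h2]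
  simpa [dist_eq_norm] using hg.dist_le_mul (u x) (v x)

end Domain

/-! ### Sign and logarithmic bound of the regularized nonlinearity. -/

section Potential

theorem deriv_Flog1 {δ : ℝ} (hδ : 0 < δ) : deriv (Flog1 δ) = fun ξ =>
    1 / 2 * Real.log ((ξ + 1) ^ 2 + δ) - 1 / 2 * Real.log ((ξ - 1) ^ 2 + δ) :=
  funext fun ξ => (hasDerivAt_Flog1 hδ ξ).deriv

theorem continuous_deriv_Flog1 {δ : ℝ} (hδ : 0 < δ) : Continuous (deriv (Flog1 δ)) := by
  rw [deriv_Flog1 hδ]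
  have h1 : ∀ ξ : ℝ, (ξ + 1) ^ 2 + δ ≠ 0 := fun ξ => by positivity
  have h2 : ∀ ξ : ℝ, (ξ - 1) ^ 2 + δ ≠ 0 := fun ξ => by positivity
  fun_prop (disch := assumption)

theorem mul_deriv_Flog1_nonneg {δ : ℝ} (hδ : 0 < δ) (ξ : ℝ) : 0 ≤ deriv (Flog1 δ) ξ * ξ := by
  rw [deriv_Flog1 hδ]
  have h1 : 0 < (ξ + 1) ^ 2 + δ := by positivity
  have h2 : 0 < (ξ - 1) ^ 2 + δ := by positivity
  rcases le_total 0 ξ with h | h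
  · have := Real.log_le_log h2 (by linarith : (ξ - 1) ^ 2 + δ ≤ (ξ + 1) ^ 2 + δ)
    exact mul_nonneg (by linarith) h
  · have := Real.log_le_log h1 (by linarith : (ξ + 1) ^ 2 + δ ≤ (ξ - 1) ^ 2 + δ)
    exact mul_nonneg_of_nonpos_of_nonpos (by linarith) h

/-- Both `B` and `1` are at most `B * exp |log δ|`, so `A ≤ 10 * B * exp |log δ|`; the `9` bounds
`log 10`. -/
theorem log_sub_log_le {δ A B : ℝ} (hδ : 0 < δ) (hA : 0 < A) (hB : δ ≤ B)
    (hAB : A ≤ 2 * B + 8) : Real.log A - Real.log B ≤ 9 + |Real.log δ| := by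
  have hB0 : 0 < B := hδ.trans_le hB
  have h1 : (1 : ℝ) ≤ Real.exp |Real.log δ| := Real.one_le_exp (abs_nonneg _)
  have h2 : 1 ≤ B * Real.exp |Real.log δ| := by
    have h3 : Real.exp (-Real.log δ) ≤ Real.exp |Real.log δ| :=
      Real.exp_le_exp.2 (neg_le_abs _)
    rw [Real.exp_neg, Real.exp_log hδ] at h3
    calc (1 : ℝ) = δ * δ⁻¹ := (mul_inv_cancel₀ hδ.ne').symm
      _ ≤ B * Real.exp |Real.log δ| := by gcongr
  have h4 : A ≤ 10 * (B * Real.exp |Real.log δ|) := by nlinarith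
  have h5 := Real.log_le_log hA h4
  rw [Real.log_mul (by norm_num) (by positivity), Real.log_mul hB0.ne' (by positivity),
    Real.log_exp] at h5
  have h6 : Real.log 10 ≤ 10 - 1 := Real.log_le_sub_one_of_pos (by norm_num)
  linarith

theorem abs_deriv_Flog1_le {δ : ℝ} (hδ : 0 < δ) (ξ : ℝ) :
    |deriv (Flog1 δ) ξ| ≤ 5 * (1 + |Real.log δ|) := by
  rw [deriv_Flog1 hδ]
  -- The condition `A ≤ 2 * B + 8` is `(x + 2)² ≤ 2x² + 8` with `x = ξ - 1`. Half of `9 + |log δ|`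
  -- is below `5 (1 + |log δ|)`.
  have h1 := log_sub_log_le hδ (A := (ξ + 1) ^ 2 + δ) (B := (ξ - 1) ^ 2 + δ) (by positivity)
    (by nlinarith [sq_nonneg (ξ - 1)]) (by nlinarith [sq_nonneg (ξ - 3)])
  have h2 := log_sub_log_le hδ (A := (ξ - 1) ^ 2 + δ) (B := (ξ + 1) ^ 2 + δ) (by positivity)
    (by nlinarith [sq_nonneg (ξ + 1)]) (by nlinarith [sq_nonneg (ξ + 3)])
  have h3 := abs_nonneg (Real.log δ)
  rw [abs_le]
  constructor <;> linarith

variable {d : ℕ} {D : Set (EuclideanSpace ℝ (Fin d))}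

theorem inner_superpose_deriv_Flog1_nonneg (hD : Bornology.IsBounded D) {δ : ℝ} (hδ : 0 < δ)
    (v : L2 D) : 0 ≤ inner ℝ (superpose (deriv (Flog1 δ)) v) v := by
  rw [L2.inner_def]
  refine integral_nonneg_of_ae ?_
  filter_upwards [coeFn_superpose hD (continuous_deriv_Flog1 hδ) (abs_deriv_Flog1_le hδ) v]
    with x hx
  rw [hx]
  simpa [mul_comm] using mul_deriv_Flog1_nonneg hδ (v x)

end Potential

/-! ### Continuity and linear growth of `B` in both noise cases. -/

section Noise

variable {d : ℕ} {D : Set (EuclideanSpace ℝ (Fin d))}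

/-- Parseval. It lets the noise hypothesis of Case 1 be used at `γ = 0`, the only level an estimate
in `H` requires. -/
theorem sobolevNorm_zero (e : HilbertBasis ℕ ℝ (L2 D)) (lam : ℕ → ℝ) (v : L2 D) :
    sobolevNorm e lam 0 v = ‖v‖ₑ := by
  have h1 : ∑' k, ‖inner ℝ (e k) v‖ₑ ^ 2 = ‖v‖ₑ ^ 2 := by
    have h2 := e.hasSum_inner_mul_inner v v
    have h3 : ∀ k, ‖inner ℝ (e k) v‖ₑ ^ 2
        = ENNReal.ofReal (inner ℝ v (e k) * inner ℝ (e k) v) := fun k => by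
      rw [Real.enorm_eq_ofReal_abs, ← ENNReal.ofReal_pow (abs_nonneg _), sq_abs,
        real_inner_comm, sq]
    simp_rw [h3]
    rw [← ENNReal.ofReal_tsum_of_nonneg _ h2.summable, h2.tsum_eq, real_inner_self_eq_norm_sq,
      ENNReal.ofReal_pow (norm_nonneg _), ofReal_norm]
    exact fun k => by rw [real_inner_comm]; exact mul_self_nonneg _
  rw [sobolevNorm]
  simp only [Real.rpow_zero, ENNReal.ofReal_one, one_mul]
  rw [tsum_eq_zero_add' ENNReal.summable] at h1
  rw [h1, ← ENNReal.rpow_natCast, ← ENNReal.rpow_mul]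
  norm_num

theorem tsum_enorm_sq_eq_hsNorm_sq (e : HilbertBasis ℕ ℝ (L2 D)) (lam : ℕ → ℝ)
    (S : L2 D →L[ℝ] L2 D) : ∑' i, ‖S (e i)‖ₑ ^ 2 = hsNorm e lam 0 S ^ 2 := by
  rw [hsNorm, ← ENNReal.rpow_natCast, ← ENNReal.rpow_mul]
  simp only [sobolevNorm_zero]
  norm_num

theorem sum_norm_sq_le_of_tsum_enorm_sq_le {E : Type*} [SeminormedAddCommGroup E] {b : ℕ → E}
    {M : ℝ} (hM : 0 ≤ M) (h : ∑' i, ‖b i‖ₑ ^ 2 ≤ ENNReal.ofReal M) (n : ℕ) :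
    ∑ i ∈ Finset.range n, ‖b i‖ ^ 2 ≤ M := by
  have h1 := (ENNReal.sum_le_tsum (Finset.range n)).trans h
  have h2 : ∀ i, ‖b i‖ₑ ^ 2 = ENNReal.ofReal (‖b i‖ ^ 2) := fun i => by
    rw [ENNReal.ofReal_pow (norm_nonneg _), ofReal_norm]
  simp_rw [h2] at h1
  rw [← ENNReal.ofReal_sum_of_nonneg fun i _ => by positivity] at h1
  exact (ENNReal.ofReal_le_ofReal_iff hM).1 h1

/-- A single `‖S (e i)‖` is bounded by the Hilbert–Schmidt norm, which gives continuity; growth is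
the second inequality squared. -/
theorem NoiseCase1.exists_bound {e : HilbertBasis ℕ ℝ (L2 D)} {lam : ℕ → ℝ} {s : ℝ}
    (hs : 0 ≤ s) {B : L2 D → L2 D →L[ℝ] L2 D} (h : NoiseCase1 e lam s B) :
    (∀ i, Continuous fun v => B v (e i)) ∧ ∃ K : ℝ, 0 ≤ K ∧
      ∀ v n, ∑ i ∈ Finset.range n, ‖B v (e i)‖ ^ 2 ≤ K * (1 + ‖v‖ ^ 2) := by
  obtain ⟨K, hK⟩ := h
  have hK0 : ∀ u v : L2 D, hsNorm e lam 0 (B u - B v) ≤ K * ‖u - v‖ₑ ∧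
      hsNorm e lam 0 (B u) ≤ K * (1 + ‖u‖ₑ) := fun u v => by
    have := hK 0 le_rfl hs u v
    simp only [sobolevNorm_zero] at this
    exact this enorm_lt_top enorm_lt_top
  refine ⟨fun i => ?_, 2 * K ^ 2, by positivity, fun v n => ?_⟩
  · refine LipschitzWith.continuous (K := K) fun u v => ?_
    rw [edist_eq_enorm_sub, edist_eq_enorm_sub]
    refine le_trans ?_ (hK0 u v).1
    have h1 := ENNReal.le_tsum (f := fun i => ‖(B u - B v) (e i)‖ₑ ^ 2) i
    rw [tsum_enorm_sq_eq_hsNorm_sq e lam] at h1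
    exact (ENNReal.pow_le_pow_left_iff two_ne_zero).1 h1
  · have h1 : ∑' i, ‖B v (e i)‖ₑ ^ 2 ≤ ENNReal.ofReal ((K * (1 + ‖v‖)) ^ 2) := by
      rw [tsum_enorm_sq_eq_hsNorm_sq e lam, ENNReal.ofReal_pow (by positivity),
        ENNReal.ofReal_mul (by positivity), ENNReal.ofReal_add (by positivity) (by positivity),
        ofReal_norm, ENNReal.ofReal_coe_nnreal, ENNReal.ofReal_one]
      gcongr
      exact (hK0 v v).2
    refine (sum_norm_sq_le_of_tsum_enorm_sq_le (by positivity) h1 n).trans ?_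
    rw [mul_pow, mul_comm 2, mul_assoc]
    gcongr
    nlinarith [sq_nonneg (‖v‖ - 1)]

theorem MemW0.abs_le {s : ℝ} {h : ℝ → ℝ} (hh : MemW0 s h) (x : ℝ) :
    |h x| ≤ (wNorm s h).toReal := by
  have h1 : ‖h x‖ₑ ≤ wNorm s h := by
    calc ‖h x‖ₑ ≤ ⨆ x, ‖iteratedDeriv 0 h x‖ₑ := by
          simpa using le_iSup (fun x => ‖h x‖ₑ) x
      _ ≤ ∑ k ∈ Finset.range (⌊s⌋₊ + 1), ⨆ x, ‖iteratedDeriv k h x‖ₑ :=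
          Finset.single_le_sum (f := fun k => ⨆ x, ‖iteratedDeriv k h x‖ₑ)
            (fun _ _ => zero_le) (by simp)
      _ ≤ wNorm s h := by
          rw [wNorm, add_assoc]
          exact le_self_add
  have h2 := ENNReal.toReal_mono hh.finite.ne h1
  simpa using h2

/-- If `⌊s⌋₊ = 0`, the Lipschitz seminorm of `h` itself is a summand of `wNorm`; otherwise the
supremum of `h'` is. -/
theorem MemW0.lipschitz {s : ℝ} {h : ℝ → ℝ} (hh : MemW0 s h) :
    ∃ K : ℝ≥0, LipschitzWith K h := by
  have hfin := hh.finite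
  rw [wNorm, add_assoc, ENNReal.add_lt_top, ENNReal.add_lt_top, ENNReal.sum_lt_top] at hfin
  rcases Nat.eq_zero_or_pos ⌊s⌋₊ with h0 | hpos
  · have h1 := hfin.2.1
    rw [h0, iteratedDeriv_zero, eHolderNorm_lt_top] at h1
    obtain ⟨K, hK⟩ := h1
    exact ⟨K, holderWith_one.1 hK⟩
  · have h1 := hfin.1 1 (by simp; omega)
    rw [iteratedDeriv_one] at h1
    refine ⟨(⨆ x, ‖deriv h x‖ₑ).toNNReal, lipschitzWith_of_nnnorm_deriv_le
      (hh.contDiff.differentiable (by exact_mod_cast hpos.ne')) fun x => ?_⟩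
    rw [← ENNReal.coe_le_coe, ENNReal.coe_toNNReal h1.ne]
    exact le_iSup (fun x => ‖deriv h x‖ₑ) x

/-- Bounded `h i` on a domain of finite volume give a bound uniform in `v`, stronger than linear
growth. Continuity of `v ↦ B v (e i)` comes from the Lipschitz property of `h i`. -/
theorem NoiseCase2.exists_bound (hD : Bornology.IsBounded D) {e : HilbertBasis ℕ ℝ (L2 D)}
    {s : ℝ} {B : L2 D → L2 D →L[ℝ] L2 D} (h : NoiseCase2 e s B) :
    (∀ i, Continuous fun v => B v (e i)) ∧ ∃ K : ℝ, 0 ≤ K ∧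
      ∀ v n, ∑ i ∈ Finset.range n, ‖B v (e i)‖ ^ 2 ≤ K * (1 + ‖v‖ ^ 2) := by
  obtain ⟨h, hmem, hsum, hB⟩ := h
  refine ⟨fun i => ?_, domainConst D ^ 2 * (∑' i, wNorm s (h i) ^ 2).toReal, by positivity,
    fun v n => ?_⟩
  · obtain ⟨K, hK⟩ := (hmem i).lipschitz
    simp_rw [hB]
    exact continuous_superpose hD hK (hmem i).abs_le
  · have h1 : ∑ i ∈ Finset.range n, (wNorm s (h i)).toReal ^ 2
        ≤ (∑' i, wNorm s (h i) ^ 2).toReal := by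
      have h2 := ENNReal.toReal_mono hsum.ne
        (ENNReal.sum_le_tsum (f := fun i => wNorm s (h i) ^ 2) (Finset.range n))
      rw [ENNReal.toReal_sum fun i _ => by simp [(hmem i).finite.ne]] at h2
      simpa using h2
    calc ∑ i ∈ Finset.range n, ‖B v (e i)‖ ^ 2
        ≤ ∑ i ∈ Finset.range n, domainConst D ^ 2 * (wNorm s (h i)).toReal ^ 2 := by
          refine Finset.sum_le_sum fun i _ => ?_
          rw [hB, ← mul_pow]
          gcongr
          obtain ⟨K, hK⟩ := (hmem i).lipschitz
          exact norm_superpose_le hD hK.continuous (hmem i).abs_le v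
      _ = domainConst D ^ 2 * ∑ i ∈ Finset.range n, (wNorm s (h i)).toReal ^ 2 :=
          (Finset.mul_sum _ _ _).symm
      _ ≤ domainConst D ^ 2 * (∑' i, wNorm s (h i) ^ 2).toReal := by gcongr
      _ ≤ _ := le_mul_of_one_le_right (by positivity) (by linarith [sq_nonneg ‖v‖])

end Noise

/-! ### Moment growth along the scheme. -/

section Moments

theorem eLpNorm_two_mul_le_of_lintegral_le {Ω E : Type*} {mΩ : MeasurableSpace Ω}
    {P : Measure Ω} [NormedAddCommGroup E] {u : Ω → E} {m : ℕ} (hm : m ≠ 0) {R : ℝ} (hR : 0 ≤ R)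
    (h : ∫⁻ ω, ENNReal.ofReal ((‖u ω‖ ^ 2) ^ m) ∂P ≤ ENNReal.ofReal (R ^ (2 * m))) :
    eLpNorm u ((2 * m : ℕ) : ℝ≥0∞) P ≤ ENNReal.ofReal R := by
  have h0 : 2 * m ≠ 0 := by omega
  rw [eLpNorm_eq_lintegral_rpow_enorm_toReal (by exact_mod_cast h0) (ENNReal.natCast_ne_top _)]
  have h1 : ∀ ω, ‖u ω‖ₑ ^ ((2 * m : ℕ) : ℝ≥0∞).toReal
      = ENNReal.ofReal ((‖u ω‖ ^ 2) ^ m) := fun ω => by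
    rw [ENNReal.toReal_natCast, ENNReal.rpow_natCast, ← pow_mul,
      ENNReal.ofReal_pow (norm_nonneg _), ofReal_norm]
  simp_rw [h1]
  refine (ENNReal.rpow_le_rpow h (by positivity)).trans (le_of_eq ?_)
  rw [ENNReal.ofReal_pow hR, ← ENNReal.rpow_natCast, ← ENNReal.rpow_mul, ENNReal.toReal_natCast,
    mul_one_div_cancel (by exact_mod_cast h0), ENNReal.rpow_one]

variable {Ω : Type*} {mΩ : MeasurableSpace Ω} {P : Measure Ω} {ℱ : Filtration ℝ≥0 mΩ}
  {β : ℕ → ℝ≥0 → Ω → ℝ}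

theorem IsCylindricalWiener.measurable (hW : IsCylindricalWiener P ℱ β) (i : ℕ) (t : ℝ≥0) :
    Measurable (β i t) :=
  (hW.adapted i t).mono (ℱ.le t) le_rfl

theorem IsCylindricalWiener.iIndepFun_increment (hW : IsCylindricalWiener P ℱ β) (s t : ℝ≥0) :
    iIndepFun (fun i ω => β i t ω - β i s ω) P :=
  hW.indep.comp (fun _ f => f t - f s) fun _ =>
    (measurable_pi_apply t).sub (measurable_pi_apply s)

theorem IsCylindricalWiener.map_increment (hW : IsCylindricalWiener P ℱ β) (i : ℕ) (s τ : ℝ≥0) :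
    P.map (fun ω => β i (s + τ) ω - β i s ω) = gaussianReal 0 τ := by
  have h := ((hW.brownian i).hasLaw_sub (s + τ) s).map_eq
  have h1 : nndist ((s + τ : ℝ≥0) : ℝ) (s : ℝ) = τ := by
    ext
    simp
  have h2 : β i (s + τ) - β i s = fun ω => β i (s + τ) ω - β i s ω := rfl
  rw [h2] at h
  rw [h]
  congr 1

variable {d : ℕ} {D : Set (EuclideanSpace ℝ (Fin d))}

/-- Turns `√L` into the announced rate, with `t = √τ` and `l = |ln δ|`: `t (1 + l) ≤ (S + 1)(1 + l
t)`, since `t ≤ S`. -/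
theorem one_add_sq_le_sq {a M l t S : ℝ} (ha : 0 ≤ a) (hM : 0 ≤ M) (hl : 0 ≤ l) (ht : 0 ≤ t)
    (htS : t ≤ S) :
    1 + t ^ 2 * (M * (1 + l)) ^ 2 + a ^ 2 ≤ ((1 + a + M * (S + 1)) * (1 + l * t)) ^ 2 := by
  have hS : 0 ≤ S := ht.trans htS
  have hlt : 0 ≤ l * t := mul_nonneg hl ht
  have h1 : t * (1 + l) ≤ (S + 1) * (1 + l * t) := by
    nlinarith [mul_nonneg hS hlt]
  have h2 : (M * (t * (1 + l))) ^ 2 ≤ (M * ((S + 1) * (1 + l * t))) ^ 2 := by gcongr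
  have h3 : 1 + a ^ 2 ≤ ((1 + a) * (1 + l * t)) ^ 2 := by
    calc 1 + a ^ 2 ≤ (1 + a) ^ 2 := by nlinarith
      _ ≤ _ := by
        gcongr
        exact le_mul_of_one_le_right (by positivity) (by linarith)
  have h4 : 0 ≤ (1 + a) * (1 + l * t) * (M * ((S + 1) * (1 + l * t))) := by positivity
  linarith

/-- Growth of the moments in one step of the scheme. -/
theorem IsScheme.lintegral_step_le [IsProbabilityMeasure P] (hW : IsCylindricalWiener P ℱ β)
    (hD : Bornology.IsBounded D) {bc : BoundaryCondition d} {e : HilbertBasis ℕ ℝ (L2 D)}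
    {B : L2 D → L2 D →L[ℝ] L2 D} {u₀ : L2 D} {c α ε δ : ℝ} {N J : ℕ} {τ : ℝ≥0}
    {u : ℕ → Ω → L2 D} (hu : IsScheme bc e B u₀ c α ε δ P ℱ β N J τ u) (hδ : 0 < δ)
    (hτ : 0 < τ) {T K θ : ℝ} (hT : τ ≤ T) (hK : 0 ≤ K) (hθ : |θ| ≤ K)
    (hBc : ∀ i, Continuous fun v => B v (e i))
    (hB : ∀ v n, ∑ i ∈ Finset.range n, ‖B v (e i)‖ ^ 2 ≤ K * (1 + ‖v‖ ^ 2))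
    (hstep : ∀ a b f x Au : L2 D, a ∈ Submodule.span ℝ (e '' Set.Iic N) →
      b ∈ Submodule.span ℝ (e '' Set.Iic N) → 0 ≤ inner ℝ f a → IsLaplacian bc b Au →
      b = a + (τ : ℝ) • (Au + (2 * c) • b) - (τ : ℝ) • galerkinProj e N f
        - (α * τ) • (b - a) + ε • galerkinProj e N x →
      ‖b‖ ^ 2 ≤ (1 + K * τ) * ‖a‖ ^ 2 + K * (τ * (τ * ‖f‖ ^ 2))
        + K * ‖galerkinProj e N x‖ ^ 2 + θ * inner ℝ (galerkinProj e N x) a)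
    {L : ℝ} (hL : L = 1 + τ * (domainConst D * (5 * (1 + |Real.log δ|))) ^ 2)
    {m : ℕ} (hm : Even m) {j : ℕ} (hj : j < J) :
    ∫⁻ ω, ENNReal.ofReal ((L + ‖u (j + 1) ω‖ ^ 2) ^ m) ∂P
      ≤ ENNReal.ofReal (1 + growthConst K T m * τ)
        * ∫⁻ ω, ENNReal.ofReal ((L + ‖u j ω‖ ^ 2) ^ m) ∂P := by
  have := isFiniteMeasure_restrict hD
  let _ : MeasurableSpace (L2 D) := borel _
  have : BorelSpace (L2 D) := ⟨rfl⟩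
  have : Fact ((2 : ℝ≥0∞) ≠ ∞) := ⟨by simp⟩
  have hL1 : 1 ≤ L := by
    rw [hL]
    exact le_add_of_nonneg_right (by positivity)
  have hjs : ((j + 1 : ℕ) : ℝ≥0) * τ = j * τ + τ := by push_cast; ring
  obtain ⟨X, hX, hXu⟩ := hu.step j hj
  rw [IsNoiseIncrement, hjs] at hX
  have hpast := hW.indep_past (j * τ) (j * τ + τ) le_self_add
  refine lintegral_step_pow_le (ℱ.le (j * τ)) (fun i => (hW.measurable i _).sub
    (hW.measurable i _)) (hW.iIndepFun_increment _ _) hτ (fun i => hW.map_increment i _ τ)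
    hpast e.orthonormal (Finset.range (N + 1)) (hu.adapted j hj.le).measurable hBc hK hT hθ
    hL1 hB hX hm ?_
  filter_upwards [hXu, hu.mem_span j hj.le, hu.mem_span (j + 1) hj] with ω h1 h2 h3
  obtain ⟨Au, hAu, heq⟩ := h1
  have h4 := hstep _ _ _ _ _ h2 h3 (inner_superpose_deriv_Flog1_nonneg hD hδ (u j ω)) hAu heq
  -- The nonlinear cost is at most `K τ (L - 1)`, so adding `L` to both sides hides it in the factor
  -- `1 + K τ`.
  have h5 := norm_superpose_le hD (continuous_deriv_Flog1 hδ) (abs_deriv_Flog1_le hδ) (u j ω)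
  have h6 : K * (τ * (τ * ‖superpose (deriv (Flog1 δ)) (u j ω)‖ ^ 2)) ≤ K * (τ * (L - 1)) := by
    rw [hL, add_sub_cancel_left]
    gcongr
  rw [norm_galerkinProj_sq, inner_galerkinProj] at h4
  have h7 : 0 ≤ K * τ := by positivity
  linarith

end Moments

end LogSAC

/-! ### Discrete Gronwall argument and conclusion. -/

theorem mainTheorem10 {d : ℕ} (bc : LogSAC.BoundaryCondition d)
    (D : Set (EuclideanSpace ℝ (Fin d))) (hD : bc.Admissible D)
    (e : HilbertBasis ℕ ℝ (LogSAC.L2 D)) (lam : ℕ → ℝ) (he : LogSAC.IsEigenbasis bc e lam)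
    (s : ℝ) (hs : 0 ≤ s)
    (u₀ : LogSAC.L2 D) (hu₀ : LogSAC.IsInitialValue e lam s u₀)
    (B : LogSAC.L2 D → LogSAC.L2 D →L[ℝ] LogSAC.L2 D)
    (hB : LogSAC.NoiseCase1 e lam s B ∨ LogSAC.NoiseCase2 e s B)
    (c α : ℝ) (hc : 0 ≤ c) (hα : 0 ≤ α) (εmax : ℝ)
    (T : ℝ≥0) (hT : 0 < T) (p : ℝ) (hp : 1 ≤ p) :
    ∃ C : ℝ, ∀ (Ω : Type*) (mΩ : MeasurableSpace Ω) (P : Measure Ω) (ℱ : Filtration ℝ≥0 mΩ)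
      (β : ℕ → ℝ≥0 → Ω → ℝ), IsProbabilityMeasure P → LogSAC.IsCylindricalWiener P ℱ β →
      ∀ ε δ : ℝ, 0 ≤ ε → ε ≤ εmax → 0 < δ →
      ∀ (J : ℕ) (τ : ℝ≥0), 1 ≤ J → J * τ = T →
      ∀ N : ℕ, 1 ≤ N → (∀ k ≤ N, 1 + (α - 2 * c + lam k) * τ ≠ 0) →
      ∀ u : ℕ → Ω → LogSAC.L2 D, LogSAC.IsScheme bc e B u₀ c α ε δ P ℱ β N J τ u →
      ∀ j ≤ J, eLpNorm (u j) (ENNReal.ofReal (2 * p)) P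
        ≤ ENNReal.ofReal (C * (1 + |Real.log δ| * √(τ : ℝ))) := by
  have hDb := hD.isBounded
  obtain ⟨hBc, K₁, hK₁, hB₁⟩ : (∀ i, Continuous fun v => B v (e i)) ∧ ∃ K : ℝ, 0 ≤ K ∧
      ∀ v n, ∑ i ∈ Finset.range n, ‖B v (e i)‖ ^ 2 ≤ K * (1 + ‖v‖ ^ 2) :=
    hB.elim (fun h => h.exists_bound hs) (fun h => h.exists_bound hDb)
  obtain ⟨K₂, hK₂, hstep⟩ := LogSAC.exists_step_bound e he hc hα εmax hT
  set K := K₁ + K₂ with hK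
  have hK0 : 0 ≤ K := by positivity
  -- An even integer with `2 * p ≤ 2 * m`; the exponent `2 * p` is reached at the end by
  -- monotonicity of `L^q` norms on a probability space.
  set m : ℕ := 2 * ⌈p⌉₊ with hm
  have hpm : p ≤ m := by
    have h1 := Nat.le_ceil p
    rw [hm]; push_cast; linarith
  have hm1 : 1 ≤ m := by exact_mod_cast hp.trans hpm
  set G := LogSAC.growthConst K T m with hG
  have hG0 : 0 ≤ G := LogSAC.growthConst_nonneg hK0 m
  set M := 5 * LogSAC.domainConst D with hM
  have hM0 : 0 ≤ M := mul_nonneg (by norm_num) LogSAC.domainConst_nonneg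
  refine ⟨Real.exp (G * T) * (1 + ‖u₀‖ + M * (√T + 1)), ?_⟩
  intro Ω mΩ P ℱ β hP hW ε δ hε0 hε hδ J τ hJ hJτ N _ hN u hu j hj
  obtain ⟨θ, hθ, hst⟩ := hstep ε hε0 hε J τ hJ hJτ
  have hτ : 0 < τ := by
    rcases eq_zero_or_pos τ with rfl | h
    · rw [mul_zero] at hJτ; exact absurd hJτ hT.ne
    · exact h
  have hJτ' : (J : ℝ) * τ = T := by exact_mod_cast hJτ
  have hτT : (τ : ℝ) ≤ T := by
    rw [← hJτ']
    exact le_mul_of_one_le_left τ.2 (by exact_mod_cast hJ)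
  set l := |Real.log δ| with hl
  have hl0 : 0 ≤ l := abs_nonneg _
  set L : ℝ := 1 + τ * (LogSAC.domainConst D * (5 * (1 + l))) ^ 2 with hL
  have hL0 : 0 ≤ L := by positivity
  have hgrow : ∀ i ≤ J, ∫⁻ ω, ENNReal.ofReal ((L + ‖u i ω‖ ^ 2) ^ m) ∂P
      ≤ ENNReal.ofReal (Real.exp (G * τ * i) * (L + ‖u₀‖ ^ 2) ^ m) := by
    intro i
    induction i with
    | zero =>
      intro _
      calc _ ≤ ∫⁻ _, ENNReal.ofReal ((L + ‖u₀‖ ^ 2) ^ m) ∂P := by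
            refine lintegral_mono_ae ?_
            filter_upwards [hu.init] with ω hω
            have := LogSAC.norm_galerkinProj_le e N u₀
            rw [hω]
            gcongr
        _ = _ := by simp
    | succ i ih =>
      intro hi
      refine (hu.lintegral_step_le hW hDb hδ hτ hτT hK0 (hθ.trans (by linarith)) hBc
        (fun v n => (hB₁ v n).trans ?_) ?_ hL (hm ▸ even_two_mul _) hi).trans ?_
      · gcongr
        linarith
      · intro a b f x Au ha hb hf hA heq
        refine (hst N hN a b f x Au ha hb hf hA heq).trans ?_
        have hKK : K₂ ≤ K := by linarith
        gcongr
      · refine (mul_le_mul_right (ih (by omega)) _).trans ?_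
        rw [← ENNReal.ofReal_mul (by positivity)]
        apply ENNReal.ofReal_le_ofReal
        have h1 : 1 + G * τ ≤ Real.exp (G * τ) := by
          rw [add_comm]; exact Real.add_one_le_exp _
        calc _ ≤ Real.exp (G * τ) * (Real.exp (G * τ * i) * (L + ‖u₀‖ ^ 2) ^ m) := by
              gcongr
          _ = _ := by
              rw [← mul_assoc, ← Real.exp_add]
              push_cast
              ring_nf
  have hexp : Real.exp (G * τ * j) ≤ Real.exp (G * T) := by
    rw [Real.exp_le_exp, ← hJτ', mul_assoc, mul_comm (τ : ℝ)]
    gcongr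
  have hτs : √(τ : ℝ) ≤ √T := Real.sqrt_le_sqrt hτT
  set A := 1 + ‖u₀‖ + M * (√T + 1) with hA
  set y := 1 + l * √(τ : ℝ) with hy
  have hy1 : 1 ≤ y := by rw [hy]; linarith [mul_nonneg hl0 (Real.sqrt_nonneg (τ : ℝ))]
  have hA0 : 0 ≤ A := by positivity
  have hLA : L + ‖u₀‖ ^ 2 ≤ (A * y) ^ 2 := by
    have h1 := LogSAC.one_add_sq_le_sq (norm_nonneg u₀) hM0 hl0 (Real.sqrt_nonneg (τ : ℝ)) hτs
    rw [Real.sq_sqrt τ.coe_nonneg] at h1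
    refine le_trans (le_of_eq ?_) h1
    rw [hL, hM]
    ring
  have hE1 : 1 ≤ Real.exp (G * T) := Real.one_le_exp (by positivity)
  have hfin : ∫⁻ ω, ENNReal.ofReal ((‖u j ω‖ ^ 2) ^ m) ∂P
      ≤ ENNReal.ofReal ((Real.exp (G * T) * A * y) ^ (2 * m)) := by
    calc _ ≤ ∫⁻ ω, ENNReal.ofReal ((L + ‖u j ω‖ ^ 2) ^ m) ∂P := by
          gcongr
          linarith
      _ ≤ _ := hgrow j hj
      _ ≤ _ := by
          refine ENNReal.ofReal_le_ofReal ?_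
          -- The `2m`-th root of `exp (G T)` is not taken: since `exp (G T) ≥ 1`, it is bounded by
          -- its own `2m`-th power.
          rw [mul_assoc (Real.exp (G * T)), mul_pow, pow_mul (A * y)]
          exact mul_le_mul (hexp.trans (le_self_pow₀ hE1 (by omega)))
            (pow_le_pow_left₀ (by positivity) hLA m) (by positivity) (by positivity)
  refine (eLpNorm_le_eLpNorm_of_exponent_le (q := ((2 * m : ℕ) : ℝ≥0∞)) ?_
    ((hu.adapted j hj).mono (ℱ.le _)).aestronglyMeasurable).trans
    (LogSAC.eLpNorm_two_mul_le_of_lintegral_le (by omega) (by positivity) hfin)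
  rw [← ENNReal.ofReal_natCast]
  apply ENNReal.ofReal_le_ofReal
  push_cast
  linarith
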